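/- Let $k$ be an algebraically closed field of characteristic zero. A fusion category over $k$ is a semisimple $k$-linear abelian rigid monoidal category with $k$-bilinear tensor product, finite-dimensional spaces of morphisms, finitely many isomorphism classes of simple objects and simple unit object; it is pointed if every simple object is invertible with respect to $\otimes$. For a finite abelian group $A$ and a function $q\colon A\to k^\times$ that is a quadratic form (that is, $q(-x)=q(x)$ and $\sigma(x,y)=q(x+y)/(q(x)q(y))$ is bimultiplicative), let $\mathcal{C}(A,q)$ denote the pointed braided fusion category over $k$, unique up to $k$-linear braided monoidal equivalence, for which $A$ is the group of isomorphism classes of simple objects under $\otimes$ and the braiding of each simple object $X_a$ in the class $a\in A$ with itself is $c_{X_a,X_a}=q(a)\,\mathrm{id}_{X_a\otimes X_a}$. Write $\widehat{A}=\mathrm{Hom}(A,k^\times)$ and $\langle\varphi,a\rangle=\varphi(a)$. **Proposition.** Let $A$ be a finite abelian group, let $q\colon A\to k^\times$ be a quadratic form, and let $\mathcal{C}=\mathcal{C}(A,q)$ be a pointed braided fusion category over $k$ with invariant $(A,q)$. Put $$Q(a,\varphi)=\langle\varphi,a\rangle\,q(a),\qquad a\in A,\ \varphi\in\widehat{A}.$$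 Then the Drinfeld center $\mathcal{Z}(\mathcal{C})$ is a pointed braided fusion category, $Q$ is a quadratic form on $A\oplus\widehat{A}$, and there is a $k$-linear braided monoidal equivalence $\mathcal{Z}(\mathcal{C})\simeq\mathcal{C}(A\oplus\widehat{A},Q)$. That is, the group of isomorphism classes of simple objects of $\mathcal{Z}(\mathcal{C})$ with the function given by self-braiding is isomorphic to $(A\oplus\widehat{A},Q)$, and $\mathcal{Z}(\mathcal{C})$ is $k$-linearly braided equivalent to every pointed braided fusion category over $k$ with this invariant. -/

import Mathlib

open CategoryTheory CategoryTheory.Limits CategoryTheory.MonoidalCategory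

noncomputable section

namespace PointedCenter

/-! ### The linear structure of the Drinfeld center

Mathlib's `Center C` has as objects the pairs of an object `X` of `C` and a half-braiding
`X ⊗ U ≅ U ⊗ X`, and the braiding of two objects of `Center C` is the half-braiding of the first.
If `C` is `k`-linear, a linear combination of morphisms of the center is again a morphism of the
center, so all operations below are those of the underlying morphisms of `C`. -/

section CenterLinear

universe w v u

variable {C : Type u} [Category.{v} C] [MonoidalCategory C] [Preadditive C] [MonoidalPreadditive C]

instance centerHomZero (X Y : Center C) : Zero (X ⟶ Y) :=
  ⟨{ f := 0, comm := fun U => by simp }⟩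

instance centerHomAdd (X Y : Center C) : Add (X ⟶ Y) :=
  ⟨fun f g =>
    { f := f.f + g.f
      comm := fun U => by simp [Preadditive.add_comp, Preadditive.comp_add] }⟩

instance centerHomNeg (X Y : Center C) : Neg (X ⟶ Y) :=
  ⟨fun f =>
    { f := -f.f
      comm := fun U => by
        have h1 : (-f.f) ▷ U = -(f.f ▷ U) := by
          rw [eq_neg_iff_add_eq_zero, ← MonoidalPreadditive.add_whiskerRight]; simp
        have h2 : U ◁ (-f.f) = -(U ◁ f.f) := by
          rw [eq_neg_iff_add_eq_zero, ← MonoidalPreadditive.whiskerLeft_add]; simp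
        rw [h1, h2, Preadditive.neg_comp, Preadditive.comp_neg, f.comm] }⟩

@[simp] theorem center_zero_f (X Y : Center C) : (0 : X ⟶ Y).f = 0 := rfl

@[simp] theorem center_add_f {X Y : Center C} (f g : X ⟶ Y) : (f + g).f = f.f + g.f := rfl

@[simp] theorem center_neg_f {X Y : Center C} (f : X ⟶ Y) : (-f).f = -f.f := rfl

instance centerHomAddCommGroup (X Y : Center C) : AddCommGroup (X ⟶ Y) where
  add_assoc f g h := by ext; simp [add_assoc]
  zero_add f := by ext; simp
  add_zero f := by ext; simp
  add_comm f g := by ext; simp [add_comm]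
  neg_add_cancel f := by ext; simp
  nsmul := nsmulRec
  zsmul := zsmulRec

instance centerPreadditive : Preadditive (Center C) where
  add_comp _ _ _ f g h := by ext; simp [Preadditive.add_comp]
  comp_add _ _ _ f g h := by ext; simp [Preadditive.comp_add]

instance centerMonoidalPreadditive : MonoidalPreadditive (Center C) where
  whiskerLeft_zero := by intros; ext; simp; rfl
  zero_whiskerRight := by intros; ext; simp; rfl
  whiskerLeft_add := by intros; ext; simp; rfl
  add_whiskerRight := by intros; ext; simp; rfl

variable (k : Type w) [Field k] [Linear k C] [MonoidalLinear k C]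

instance centerHomSMul (X Y : Center C) : SMul k (X ⟶ Y) :=
  ⟨fun r f => { f := r • f.f, comm := fun U => by simp }⟩

@[simp] theorem center_smul_f {X Y : Center C} (r : k) (f : X ⟶ Y) : (r • f).f = r • f.f := rfl

instance centerHomModule (X Y : Center C) : Module k (X ⟶ Y) where
  one_smul f := by ext; simp
  mul_smul r s f := by ext; simp [mul_smul]
  smul_zero r := by ext; simp
  smul_add r f g := by ext; simp
  add_smul r s f := by ext; simp [add_smul]
  zero_smul f := by ext; simp

instance centerLinear : Linear k (Center C) where
  homModule := fun X Y => centerHomModule k X Y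
  smul_comp _ _ _ r f g := by ext; simp
  comp_smul _ _ _ f r g := by ext; simp

instance centerMonoidalLinear : MonoidalLinear k (Center C) where
  whiskerLeft_smul := by intros; ext; simp; rfl
  smul_whiskerRight := by intros; ext; simp; rfl

end CenterLinear

/-! ### Pointed braided fusion categories -/

section Fusion

universe w v u

/-- The given preadditive structure on `C` is that of an abelian category. (This is the conjunction
of the fields of Mathlib's `Abelian`, as a property of a preadditive category.) -/
structure IsAbelian (C : Type u) [Category.{v} C] [Preadditive C] : Prop where
  hasFiniteProducts : HasFiniteProducts C
  hasKernels : HasKernels C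
  hasCokernels : HasCokernels C
  isNormalMonoCategory : IsNormalMonoCategory C
  isNormalEpiCategory : IsNormalEpiCategory C

/-- `C` is a fusion category over `k`: a `k`-linear abelian rigid monoidal category (with
`k`-bilinear tensor product) with finite-dimensional spaces of morphisms, simple unit object and
finitely many isomorphism classes of simple objects, which is semisimple, i.e. every object is a
finite direct sum of simple objects. (Hence all objects have finite length and are projective.) -/
structure IsFusionCategory (k : Type w) [Field k] (C : Type u) [Category.{v} C] [Preadditive C]
    [Linear k C] [MonoidalCategory C] [MonoidalPreadditive C] [MonoidalLinear k C] : Prop where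
  isAbelian : IsAbelian C
  rigid : Nonempty (RigidCategory C)
  finiteDimensional_hom : ∀ X Y : C, Module.Finite k (X ⟶ Y)
  simple_unit : Simple (𝟙_ C)
  finite_simples : ∃ (n : ℕ) (S : Fin n → C), ∀ X : C, Simple X → ∃ i, Nonempty (X ≅ S i)
  semisimple : ∀ X : C, ∃ (n : ℕ) (S : Fin n → C) (b : Bicone S),
    (∀ i, Simple (S i)) ∧ Nonempty b.IsBilimit ∧ Nonempty (X ≅ b.pt)

/-- An object of a monoidal category is invertible if it has a two-sided tensor inverse. -/
def IsInvertibleObject {C : Type u} [Category.{v} C] [MonoidalCategory C] (X : C) : Prop :=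
  ∃ Y : C, Nonempty (X ⊗ Y ≅ 𝟙_ C) ∧ Nonempty (Y ⊗ X ≅ 𝟙_ C)

/-- A fusion category is pointed if all its simple objects are invertible. -/
def IsPointed (C : Type u) [Category.{v} C] [Preadditive C] [MonoidalCategory C] : Prop :=
  ∀ X : C, Simple X → IsInvertibleObject X

/-- `q : A → kˣ` is a quadratic form: `q (-x) = q x`, and `σ(x, y) = q (x + y) / (q x * q y)` is
bimultiplicative. -/
structure IsQuadraticForm {k : Type w} [Field k] {A : Type u} [AddCommGroup A] (q : A → kˣ) :
    Prop where
  map_neg : ∀ x, q (-x) = q x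
  map_add_left : ∀ x y z,
    q (x + y + z) / (q (x + y) * q z) = q (x + z) / (q x * q z) * (q (y + z) / (q y * q z))
  map_add_right : ∀ x y z,
    q (x + (y + z)) / (q x * q (y + z)) = q (x + y) / (q x * q y) * (q (x + z) / (q x * q z))

universe uA

/-- The pair formed by the group of isomorphism classes of simple objects of `C` and the function
on it given by self-braiding is isomorphic to `(A, q)`: there are representatives `X a` such that
`a ↦ [X a]` is a bijection from `A` onto the isomorphism classes of simple objects, turns addition
into the tensor product, and the braiding of `X a` with itself is the scalar `q a`. -/
def HasInvariant (k : Type w) [Field k] (C : Type u) [Category.{v} C] [Preadditive C] [Linear k C]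
    [MonoidalCategory C] [BraidedCategory C] (A : Type uA) [AddCommGroup A] (q : A → kˣ) : Prop :=
  ∃ X : A → C,
    (∀ a, Simple (X a)) ∧
    (∀ S : C, Simple S → ∃ a, Nonempty (S ≅ X a)) ∧
    (∀ a b, Nonempty (X a ≅ X b) → a = b) ∧
    (∀ a b, Nonempty (X a ⊗ X b ≅ X (a + b))) ∧
    (∀ a, (β_ (X a) (X a)).hom = (q a : k) • 𝟙 (X a ⊗ X a))

/-- `C` is a category `C(A, q)`: a pointed braided fusion category over `k` whose associated group
with quadratic form is `(A, q)`. -/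
structure IsPointedBraidedFusion (k : Type w) [Field k] (C : Type u) [Category.{v} C]
    [Preadditive C] [Linear k C] [MonoidalCategory C] [MonoidalPreadditive C] [MonoidalLinear k C]
    [BraidedCategory C] (A : Type uA) [AddCommGroup A] (q : A → kˣ) : Prop where
  isFusion : IsFusionCategory k C
  isPointed : IsPointed C
  hasInvariant : HasInvariant k C A q

universe v' u'

/-- There is a `k`-linear braided monoidal equivalence `C ⥤ D`. -/
def BraidedEquivalent (k : Type w) [Field k] (C : Type u) [Category.{v} C] [Preadditive C]
    [Linear k C] [MonoidalCategory C] [BraidedCategory C] (D : Type u') [Category.{v'} D]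
    [Preadditive D] [Linear k D] [MonoidalCategory D] [BraidedCategory D] : Prop :=
  ∃ F : C ⥤ D, Nonempty F.Braided ∧ F.IsEquivalence ∧ F.Additive ∧ F.Linear k

/-- The character group `Â = Hom(A, kˣ)`, written additively. -/
abbrev CharGroup (k : Type w) [Field k] (A : Type uA) [AddCommGroup A] : Type (max uA w) :=
  A →+ Additive kˣ

/-- The function `Q(a, φ) = ⟨φ, a⟩ q(a)` on `A ⊕ Â`. -/
def centerForm {k : Type w} [Field k] {A : Type uA} [AddCommGroup A] (q : A → kˣ) :
    A × CharGroup k A → kˣ :=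
  fun p => (p.2 p.1).toMul * q p.1

end Fusion

end PointedCenter

end

/-!
The braiding of `C` makes every object `X` an object of the center, and a half-braiding `b` on `X`
is compared with this one: on `X ⊗ S a`, with `S a` simple and thus invertible, the two differ by an
automorphism `ρ a` of `X`, and the hexagon axiom makes `ρ` an action of `A` on `X`. As `|A|` is
invertible in `k`, the object `X` is the direct sum of its isotypic parts, so every object of the
center is a direct sum of the objects `(S a, φ)`: `S a` with the braiding twisted by a character
`φ`. These are pairwise orthogonal, tensor by adding the indices, and the braiding of `(S a, φ)`
with itself is the scalar `φ a * q a`.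

For uniqueness, take a linear equivalence `F` matching the simple objects, and arbitrary natural
isomorphisms `F X ⊗ F Y ≅ F (X ⊗ Y)`. Their failure to be associative and compatible with the
braidings is measured by an abelian cocycle `(ω, c)` of `A` with values in `kˣ`, and `c a a = 1`
since the quadratic forms agree. By a theorem of Eilenberg and Mac Lane `(ω, c)` is a coboundary,
and rescaling the isomorphisms by a cochain makes `F` braided. That theorem holds on `ℤ` by a direct
computation and passes to direct sums, hence to `ℤⁿ`; it descends to the quotient `A` of `ℤⁿ`
because the obstruction, a symmetric `2`-cocycle on the kernel, defines an extension by the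
divisible group `kˣ`, which splits.
-/

namespace PointedCenter

noncomputable section

/-! ### Abelian cocycles -/

section AbelianCocycles

variable {A G M : Type*} [AddCommGroup A] [AddCommGroup G] [AddCommGroup M]
  {ω : A → A → A → M} {c : A → A → M}

/-- `(ω, c)` is an abelian `3`-cocycle of `A` with values in the trivial module `M`, in the sense of
Eilenberg and Mac Lane: `ω` and `c` satisfy the axioms of an associator and a braiding. -/
structure IsAbelianCocycle (ω : A → A → A → M) (c : A → A → M) : Prop where
  pentagon : ∀ x y z t, ω x y z + ω x (y + z) t + ω y z t = ω (x + y) z t + ω x y (z + t)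
  hexagon_forward : ∀ x y z, ω x y z + c x (y + z) + ω y z x = c x y + ω y x z + c x z
  hexagon_reverse : ∀ x y z, -ω x y z + c (x + y) z - ω z x y = c y z - ω x z y + c x z

/-- The first component of the coboundary of the abelian `2`-cochain `h`. -/
def assocCoboundary (h : A → A → M) (x y z : A) : M :=
  h y z + h x (y + z) - h x y - h (x + y) z

/-- The second component of the coboundary of the abelian `2`-cochain `h`. -/
def braidCoboundary (h : A → A → M) (x y : A) : M :=
  h y x - h x y

/-- `(ω, c)` is the coboundary of an abelian `2`-cochain. -/
def IsAbelianCoboundary (ω : A → A → A → M) (c : A → A → M) : Prop :=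
  ∃ h : A → A → M, (∀ x y z, ω x y z = assocCoboundary h x y z) ∧
    ∀ x y, c x y = braidCoboundary h x y

/-- `ω` vanishes as soon as one of its arguments does. -/
def IsNormalized (ω : A → A → A → M) : Prop :=
  ∀ x y, ω 0 x y = 0 ∧ ω x 0 y = 0 ∧ ω x y 0 = 0

theorem IsAbelianCoboundary.add {ω' : A → A → A → M} {c' : A → A → M}
    (H : IsAbelianCoboundary ω c) (H' : IsAbelianCoboundary ω' c') :
    IsAbelianCoboundary (ω + ω') (c + c') := by
  obtain ⟨h, hω, hc⟩ := H
  obtain ⟨h', hω', hc'⟩ := H'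
  refine ⟨h + h', fun x y z => ?_, fun x y => ?_⟩
  · simp only [Pi.add_apply, hω, hω', assocCoboundary]
    abel
  · simp only [Pi.add_apply, hc, hc', braidCoboundary]
    abel

theorem isAbelianCoboundary_coboundary (h : A → A → M) :
    IsAbelianCoboundary (assocCoboundary h) (braidCoboundary h) :=
  ⟨h, fun _ _ _ => rfl, fun _ _ => rfl⟩

theorem IsAbelianCoboundary.of_sub_coboundary (h : A → A → M)
    (H : IsAbelianCoboundary (ω - assocCoboundary h) (c - braidCoboundary h)) :
    IsAbelianCoboundary ω c := by
  simpa only [sub_add_cancel] using H.add (isAbelianCoboundary_coboundary h)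

theorem IsAbelianCoboundary.sub_coboundary (H : IsAbelianCoboundary ω c) (h : A → A → M) :
    IsAbelianCoboundary (ω - assocCoboundary h) (c - braidCoboundary h) := by
  refine .of_sub_coboundary (-h) ?_
  convert H using 1
  · ext x y z
    simp only [Pi.sub_apply, assocCoboundary, Pi.neg_apply]
    abel
  · ext x y
    simp only [Pi.sub_apply, braidCoboundary, Pi.neg_apply]
    abel

namespace IsAbelianCocycle

theorem comp (H : IsAbelianCocycle ω c) (f : G →+ A) :
    IsAbelianCocycle (fun x y z => ω (f x) (f y) (f z)) (fun x y => c (f x) (f y)) where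
  pentagon x y z t := by simpa using H.pentagon (f x) (f y) (f z) (f t)
  hexagon_forward x y z := by simpa using H.hexagon_forward (f x) (f y) (f z)
  hexagon_reverse x y z := by simpa using H.hexagon_reverse (f x) (f y) (f z)

theorem sub_coboundary (H : IsAbelianCocycle ω c) (h : A → A → M) :
    IsAbelianCocycle (ω - assocCoboundary h) (c - braidCoboundary h) where
  pentagon x y z t := by
    simp only [Pi.sub_apply, assocCoboundary]
    rw [add_assoc x y z, add_assoc y z t]
    linear_combination (norm := abel_nf) H.pentagon x y z t
  hexagon_forward x y z := by
    simp only [Pi.sub_apply, assocCoboundary, braidCoboundary]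
    rw [add_comm y x, add_comm z x]
    linear_combination (norm := abel) H.hexagon_forward x y z
  hexagon_reverse x y z := by
    simp only [Pi.sub_apply, assocCoboundary, braidCoboundary, add_comm z]
    linear_combination (norm := abel) H.hexagon_reverse x y z

theorem braid_add_braid_swap (H : IsAbelianCocycle ω c) (hc : ∀ x, c x x = 0) (x y : A) :
    c x y + c y x = 0 := by
  linear_combination (norm := abel_nf) hc (x + y) - H.hexagon_forward (x + y) x y
    - H.hexagon_reverse x y x - H.hexagon_reverse x y y - H.pentagon x y x y - hc x - hc y

theorem braid_zero_left (H : IsAbelianCocycle ω c) (hω : IsNormalized ω) (x : A) : c 0 x = 0 := by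
  have e := H.hexagon_reverse 0 0 x
  simp only [(hω _ _).1, (hω _ _).2.1, add_zero] at e
  linear_combination (norm := abel) -e

theorem exists_isNormalized (H : IsAbelianCocycle ω c) :
    ∃ h : A → A → M, IsNormalized (ω - assocCoboundary h) := by
  have h0 : ω 0 0 0 = 0 := by simpa using H.pentagon 0 0 0 0
  refine ⟨fun x y => ω 0 0 y - ω x 0 0, fun y z => ⟨?_, ?_, ?_⟩⟩ <;>
    simp only [Pi.sub_apply, assocCoboundary, zero_add, add_zero]
  · have e := H.pentagon 0 0 y z
    simp only [add_zero, zero_add] at e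
    linear_combination (norm := abel) e
  · have e := H.pentagon y 0 0 z
    simp only [add_zero, zero_add] at e
    linear_combination (norm := abel) h0 + h0 - e
  · have e := H.pentagon y z 0 0
    simp only [add_zero] at e
    linear_combination (norm := abel) e

end IsAbelianCocycle

/-! #### Cyclic groups -/

theorem exists_int_apply_add_one_eq_sub (g : ℤ → M) (m : M) :
    ∃ f : ℤ → M, f 0 = m ∧ ∀ i, f (i + 1) = f i - g i := by
  let f : ℤ → M
    | .ofNat n => m - ∑ j ∈ Finset.range n, g j
    | .negSucc n => m + ∑ j ∈ Finset.range (n + 1), g (.negSucc j)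
  refine ⟨f, by simp [f], ?_⟩
  rintro (n | _ | n)
  · change m - _ = m - _ - _
    simp only [Finset.sum_range_succ, Int.ofNat_eq_natCast]
    abel
  · change m - _ = m + _ - _
    simp
  · change m + _ = m + _ - _
    rw [Finset.sum_range_succ _ (n + 1)]
    abel

theorem exists_sub_assocCoboundary_one_left_eq_zero (ω : ℤ → ℤ → ℤ → M) :
    ∃ h : ℤ → ℤ → M, ∀ y z, (ω - assocCoboundary h) 1 y z = 0 := by
  choose f hf0 hf using fun k : ℤ => exists_int_apply_add_one_eq_sub (fun i => ω 1 i k) (ω 1 0 k)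
  have hf1 : ∀ k, f k 1 = 0 := fun k => by simpa [hf0] using hf k 0
  refine ⟨fun i k => f k i, fun y z => ?_⟩
  simp only [Pi.sub_apply, assocCoboundary, hf1, add_comm (1 : ℤ) y, hf]
  abel

namespace IsAbelianCocycle

theorem assoc_eq_zero_of_one_left {ω : ℤ → ℤ → ℤ → M} {c : ℤ → ℤ → M} (H : IsAbelianCocycle ω c)
    (hω : ∀ y z, ω 1 y z = 0) (x y z : ℤ) : ω x y z = 0 := by
  have hstep : ∀ x, ω (x + 1) y z = ω x y z := fun x => by
    rw [add_comm x 1]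
    linear_combination (norm := abel)
      hω x y + hω (x + y) z - hω x (y + z) - H.pentagon 1 x y z
  induction x using Int.induction_on with
  | zero => rw [← hstep, zero_add, hω]
  | succ i ih => rw [hstep, ih]
  | pred i ih => rw [← hstep, sub_add_cancel, ih]

theorem braid_eq_zero_of_assoc_eq_zero {ω : ℤ → ℤ → ℤ → M} {c : ℤ → ℤ → M}
    (H : IsAbelianCocycle ω c) (hω : ∀ x y z, ω x y z = 0) (hc : c 1 1 = 0) (x y : ℤ) :
    c x y = 0 := by
  have add_right : ∀ x y z, c x (y + z) = c x y + c x z := fun x y z => by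
    simpa [hω] using H.hexagon_forward x y z
  have add_left : ∀ x y z, c (x + y) z = c x z + c y z := fun x y z => by
    simpa [hω, add_comm (c y z)] using H.hexagon_reverse x y z
  have one_left : ∀ y, c 1 y = 0 := fun y =>
    DFunLike.congr_fun (AddMonoidHom.ext_int (f := .mk' (c 1) (add_right 1)) (g := 0) hc) y
  exact DFunLike.congr_fun (AddMonoidHom.ext_int
    (f := .mk' (fun x => c x y) (fun a b => add_left a b y)) (g := 0) (one_left y)) x

theorem isAbelianCoboundary_int {ω : ℤ → ℤ → ℤ → M} {c : ℤ → ℤ → M} (H : IsAbelianCocycle ω c)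
    (hc : c 1 1 = 0) : IsAbelianCoboundary ω c := by
  obtain ⟨h, hh⟩ := exists_sub_assocCoboundary_one_left_eq_zero ω
  have hω := (H.sub_coboundary h).assoc_eq_zero_of_one_left hh
  have hc' := (H.sub_coboundary h).braid_eq_zero_of_assoc_eq_zero hω (by simpa [braidCoboundary])
  exact .of_sub_coboundary h ⟨0, fun x y z => by simpa [assocCoboundary] using hω x y z,
    fun x y => by simpa [braidCoboundary] using hc' x y⟩

end IsAbelianCocycle

/-! #### Direct sums -/

/-- The scalar by which the isomorphism `(a ⊗ b) ⊗ (a' ⊗ b') ≅ (a ⊗ a') ⊗ (b ⊗ b')` acts, if `ω` and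
`c` are the associator and the braiding. -/
def interchange (ω : A → A → A → M) (c : A → A → M) (a b a' b' : A) : M :=
  ω a b (a' + b') - ω b a' b' + c b a' + ω a' b b' - ω a a' (b + b')

namespace IsAbelianCocycle

-- Coherence of the interchange isomorphism with the associator.
theorem assoc_add (H : IsAbelianCocycle ω c) (a₁ b₁ a₂ b₂ a₃ b₃ : A) :
    ω (a₁ + b₁) (a₂ + b₂) (a₃ + b₃) = ω a₁ a₂ a₃ + ω b₁ b₂ b₃
      - interchange ω c a₂ b₂ a₃ b₃ - interchange ω c a₁ b₁ (a₂ + a₃) (b₂ + b₃)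
      + interchange ω c a₁ b₁ a₂ b₂ + interchange ω c (a₁ + a₂) (b₁ + b₂) a₃ b₃ := by
  simp only [interchange]
  linear_combination (norm := abel_nf) - H.pentagon b₁ a₂ a₃ (b₂ + b₃)
    + H.pentagon a₂ b₁ a₃ (b₂ + b₃) + H.hexagon_forward b₁ a₂ a₃
    - H.pentagon a₁ a₂ a₃ (b₁ + b₂ + b₃) - H.pentagon a₂ a₃ b₁ b₂ - H.pentagon (a₂ + a₃) b₁ b₂ b₃
    - H.pentagon a₂ a₃ (b₁ + b₂) b₃ + H.pentagon a₂ (b₁ + a₃) b₂ b₃ + H.pentagon b₁ a₃ b₂ b₃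
    + H.pentagon a₁ b₁ a₂ b₂ + H.pentagon (a₁ + b₁) a₂ b₂ (a₃ + b₃)
    - H.pentagon (a₁ + b₁ + a₂) b₂ a₃ b₃ + H.pentagon a₁ a₂ b₁ (b₂ + a₃ + b₃)
    - H.pentagon a₁ a₂ b₁ b₂ - H.pentagon a₁ b₁ a₂ (b₂ + a₃ + b₃)
    + H.pentagon (a₁ + a₂) (b₁ + b₂) a₃ b₃ - H.pentagon (a₁ + a₂) b₁ b₂ a₃
    - H.pentagon (a₁ + a₂) b₁ (b₂ + a₃) b₃ - H.hexagon_reverse b₁ b₂ a₃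

theorem braid_add (H : IsAbelianCocycle ω c) (hc : ∀ x, c x x = 0) (a₁ b₁ a₂ b₂ : A) :
    c (a₁ + b₁) (a₂ + b₂) = c a₁ a₂ + c b₁ b₂
      - interchange ω c a₂ b₂ a₁ b₁ + interchange ω c a₁ b₁ a₂ b₂ := by
  simp only [interchange]
  linear_combination (norm := abel_nf) H.hexagon_forward b₁ a₂ b₂
    - H.pentagon a₂ b₂ b₁ a₁ - H.hexagon_reverse b₂ b₁ a₁ - H.braid_add_braid_swap hc b₁ a₁
    + H.braid_add_braid_swap hc a₁ (b₁ + b₂) + H.hexagon_forward (b₁ + b₂) a₁ a₂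
    - H.hexagon_forward (b₁ + b₂) a₂ a₁ + H.hexagon_reverse a₁ b₁ (a₂ + b₂)
    - H.hexagon_forward a₁ (a₂ + b₂) b₁ + H.hexagon_forward a₁ (b₁ + b₂) a₂

theorem isAbelianCoboundary_comp_coprod (H : IsAbelianCocycle ω c) (hc : ∀ x, c x x = 0)
    {G₁ G₂ : Type*} [AddCommGroup G₁] [AddCommGroup G₂] (f₁ : G₁ →+ A) (f₂ : G₂ →+ A)
    (H₁ : IsAbelianCoboundary (fun x y z => ω (f₁ x) (f₁ y) (f₁ z)) fun x y => c (f₁ x) (f₁ y))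
    (H₂ : IsAbelianCoboundary (fun x y z => ω (f₂ x) (f₂ y) (f₂ z)) fun x y => c (f₂ x) (f₂ y)) :
    IsAbelianCoboundary
      (fun x y z => ω (f₁.coprod f₂ x) (f₁.coprod f₂ y) (f₁.coprod f₂ z))
      fun x y => c (f₁.coprod f₂ x) (f₁.coprod f₂ y) := by
  obtain ⟨h₁, hω₁, hc₁⟩ := H₁
  obtain ⟨h₂, hω₂, hc₂⟩ := H₂
  refine ⟨fun x y => h₁ x.1 y.1 + h₂ x.2 y.2 - interchange ω c (f₁ x.1) (f₂ x.2) (f₁ y.1) (f₂ y.2),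
    fun x y z => ?_, fun x y => ?_⟩
  · have e₁ := hω₁ x.1 y.1 z.1
    have e₂ := hω₂ x.2 y.2 z.2
    simp only [AddMonoidHom.coprod_apply, H.assoc_add, assocCoboundary, Prod.fst_add, Prod.snd_add,
      map_add] at e₁ e₂ ⊢
    linear_combination (norm := abel) e₁ + e₂
  · have e₁ := hc₁ x.1 y.1
    have e₂ := hc₂ x.2 y.2
    simp only [AddMonoidHom.coprod_apply, H.braid_add hc, braidCoboundary] at e₁ e₂ ⊢
    linear_combination (norm := abel) e₁ + e₂

end IsAbelianCocycle

/-! #### Symmetric cocycles -/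

/-- `h` is a symmetric `2`-cocycle. -/
structure IsSymmetricCocycle (h : G → G → M) : Prop where
  add_apply_add : ∀ x y z, h y z + h x (y + z) = h x y + h (x + y) z
  swap : ∀ x y, h x y = h y x

/-- The extension of `G` by `M` defined by a symmetric `2`-cocycle `h`: the set `M × G` with the
addition twisted by `h`. -/
structure TwistedProd (h : G → G → M) where
  fst : M
  snd : G

namespace TwistedProd

variable {h : G → G → M}

instance : Add (TwistedProd h) := ⟨fun p q => ⟨p.1 + q.1 + h p.2 q.2, p.2 + q.2⟩⟩

instance : Zero (TwistedProd h) := ⟨⟨-h 0 0, 0⟩⟩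

instance : Neg (TwistedProd h) := ⟨fun p => ⟨-p.1 - h (-p.2) p.2 - h 0 0, -p.2⟩⟩

theorem add_def (p q : TwistedProd h) : p + q = ⟨p.1 + q.1 + h p.2 q.2, p.2 + q.2⟩ := rfl

theorem zero_def : (0 : TwistedProd h) = ⟨-h 0 0, 0⟩ := rfl

theorem neg_def (p : TwistedProd h) : -p = ⟨-p.1 - h (-p.2) p.2 - h 0 0, -p.2⟩ := rfl

end TwistedProd

namespace IsSymmetricCocycle

variable {h : G → G → M}

theorem zero_left (H : IsSymmetricCocycle h) (x : G) : h 0 x = h 0 0 := by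
  simpa using H.add_apply_add 0 0 x

/-- The group structure of the extension defined by a symmetric cocycle. -/
abbrev addCommGroup (H : IsSymmetricCocycle h) : AddCommGroup (TwistedProd h) :=
  { AddGroup.ofLeftAxioms (G := TwistedProd h)
      (fun p q r => by
        simp only [TwistedProd.add_def, add_assoc]
        rw [TwistedProd.mk.injEq]
        exact ⟨by linear_combination (norm := abel) -(H.add_apply_add p.2 q.2 r.2), rfl⟩)
      (fun p => by simp [TwistedProd.add_def, TwistedProd.zero_def, H.zero_left])
      (fun p => by
        simp only [TwistedProd.add_def, TwistedProd.zero_def, TwistedProd.neg_def,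
          neg_add_cancel, TwistedProd.mk.injEq, and_true]
        abel) with
    add_comm := fun p q => by
      rw [TwistedProd.add_def, TwistedProd.add_def, H.swap, add_comm p.1, add_comm p.2] }

/-- The inclusion of `M` in the extension defined by a symmetric cocycle. -/
def inl (H : IsSymmetricCocycle h) : letI := H.addCommGroup; M →+ TwistedProd h :=
  letI := H.addCommGroup
  AddMonoidHom.mk' (fun m => ⟨m - h 0 0, 0⟩) fun m n => by
    rw [TwistedProd.add_def, TwistedProd.mk.injEq]
    exact ⟨by dsimp only; abel, (zero_add 0).symm⟩

theorem inl_injective (H : IsSymmetricCocycle h) : Function.Injective H.inl :=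
  fun _ _ e => sub_left_injective (congrArg TwistedProd.fst e)

theorem inl_add_mk (H : IsSymmetricCocycle h) (m : M) (x : G) : H.inl m + ⟨0, x⟩ = ⟨m, x⟩ := by
  change (⟨m - h 0 0 + 0 + h 0 x, 0 + x⟩ : TwistedProd h) = ⟨m, x⟩
  rw [H.zero_left x, add_zero, sub_add_cancel, zero_add]

theorem exists_eq_add_sub (H : IsSymmetricCocycle h) (hM : Module.Baer ℤ M) :
    ∃ ψ : G → M, ∀ x y, h x y = ψ x + ψ y - ψ (x + y) := by
  let _ := H.addCommGroup
  obtain ⟨r, hr⟩ := hM.extension_property_addMonoidHom H.inl H.inl_injective (.id M)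
  have r_mk : ∀ m x, r ⟨m, x⟩ = m + r ⟨0, x⟩ := fun m x => by
    rw [← H.inl_add_mk, map_add]
    exact congrArg (· + _) (DFunLike.congr_fun hr m)
  refine ⟨fun x => r ⟨0, x⟩, fun x y => ?_⟩
  have e := map_add r ⟨0, x⟩ ⟨0, y⟩
  rw [TwistedProd.add_def, r_mk] at e
  dsimp only at e
  linear_combination (norm := abel) e

end IsSymmetricCocycle

/-! #### Descent along surjective homomorphisms -/

section Descent

variable {f : G →+ A} {h : G → G → M}

theorem assocCoboundary_eq_of_cohomologous (h : G → G → M) (Ψ : G → M) (x y z : G) :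
    assocCoboundary (fun x y => h x y - Ψ x - Ψ y + Ψ (x + y)) x y z = assocCoboundary h x y z := by
  simp only [assocCoboundary, ← add_assoc]
  abel

theorem braidCoboundary_eq_of_cohomologous (h : G → G → M) (Ψ : G → M) (x y : G) :
    braidCoboundary (fun x y => h x y - Ψ x - Ψ y + Ψ (x + y)) x y = braidCoboundary h x y := by
  simp only [braidCoboundary, add_comm y x]
  abel

theorem IsAbelianCocycle.isSymmetricCocycle_ker (H : IsAbelianCocycle ω c) (hω : IsNormalized ω)
    (hωh : ∀ x y z, ω (f x) (f y) (f z) = assocCoboundary h x y z)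
    (hch : ∀ x y, c (f x) (f y) = braidCoboundary h x y) :
    IsSymmetricCocycle fun x y : f.ker => h x y where
  add_apply_add x y z := by
    have e := hωh x y z
    rw [x.2, (hω _ _).1, assocCoboundary] at e
    simp only [AddSubgroup.coe_add]
    linear_combination (norm := abel) -e
  swap x y := by
    have e := hch x y
    rw [x.2, H.braid_zero_left hω, braidCoboundary] at e
    linear_combination (norm := abel) e

-- For a section `s` of `f`, an element `g` is the sum of `s (f g)` and an element `κ g` of the
-- kernel, on which `h` is the coboundary of `ψ`; this dictates the choice of `Ψ`.
theorem IsAbelianCocycle.exists_cohomologous_vanishing_on_ker (H : IsAbelianCocycle ω c)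
    (hM : Module.Baer ℤ M) (hω : IsNormalized ω) (hf : Function.Surjective f)
    (hωh : ∀ x y z, ω (f x) (f y) (f z) = assocCoboundary h x y z)
    (hch : ∀ x y, c (f x) (f y) = braidCoboundary h x y) :
    ∃ Ψ : G → M, ∀ x, ∀ y ∈ f.ker, h x y - Ψ x - Ψ y + Ψ (x + y) = 0 := by
  obtain ⟨ψ, hψ⟩ := (H.isSymmetricCocycle_ker hω hωh hch).exists_eq_add_sub hM
  obtain ⟨s, hs⟩ := hf.hasRightInverse
  let κ : G → f.ker := fun g => ⟨g - s (f g), by simp [AddMonoidHom.mem_ker, hs _]⟩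
  have f_coe : ∀ y : f.ker, f y = 0 := fun y => y.2
  have hκ : ∀ g, s (f g) + κ g = g := fun g => add_sub_cancel _ _
  have κ_add : ∀ g (y : f.ker), κ (g + y) = κ g + y := fun g y => by
    ext
    simp only [κ, map_add, f_coe, add_zero, AddSubgroup.coe_add]
    abel
  let Ψ : G → M := fun g => ψ (κ g) - h (s (f g)) (κ g) + ψ ⟨s 0, hs 0⟩
  have Ψ_ker : ∀ y : f.ker, Ψ y = ψ y := fun y => by
    have e := hψ ⟨s 0, hs 0⟩ (κ y)
    have hy : (⟨s 0, hs 0⟩ + κ y : f.ker) = y := by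
      ext
      simpa only [AddSubgroup.coe_add, f_coe] using hκ y
    simp only [hy] at e
    simp only [Ψ, f_coe, e]
    abel
  refine ⟨Ψ, fun x y hy => ?_⟩
  lift y to f.ker using hy
  have e := hωh (s (f x)) (κ x) y
  rw [f_coe y, (hω _ _).2.2, assocCoboundary, hκ] at e
  have e' := hψ (κ x) y
  rw [Ψ_ker]
  simp only [Ψ, κ_add, map_add, f_coe, add_zero, AddSubgroup.coe_add]
  linear_combination (norm := abel) e + e'

theorem isAbelianCoboundary_of_vanishing_on_ker (hω : IsNormalized ω)
    (hf : Function.Surjective f)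
    (hωh : ∀ x y z, ω (f x) (f y) (f z) = assocCoboundary h x y z)
    (hch : ∀ x y, c (f x) (f y) = braidCoboundary h x y)
    (hker : ∀ x, ∀ y ∈ f.ker, h x y = 0) : IsAbelianCoboundary ω c := by
  have congr_right : ∀ x {y z}, f y = f z → h x y = h x z := fun x y z hyz => by
    have hk : y - z ∈ f.ker := by simp [AddMonoidHom.mem_ker, hyz]
    have e := hωh x z (y - z)
    rw [AddMonoidHom.mem_ker.1 hk, (hω _ _).2.2, assocCoboundary, hker _ _ hk, hker _ _ hk,
      add_sub_cancel] at e
    linear_combination (norm := abel) -e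
  have congr_left : ∀ {x y} z, f x = f y → h x z = h y z := fun {x y} z hxy => by
    have e := hch z x
    rw [hxy, hch, braidCoboundary, braidCoboundary, congr_right z hxy] at e
    linear_combination (norm := abel) -e
  obtain ⟨s, hs⟩ := hf.hasRightInverse
  refine ⟨fun a b => h (s a) (s b), fun x y z => ?_, fun x y => ?_⟩
  · have e := hωh (s x) (s y) (s z)
    rw [hs, hs, hs] at e
    rw [e, assocCoboundary, assocCoboundary,
      congr_right (s x) (show f (s y + s z) = f (s (y + z)) by rw [map_add, hs, hs, hs]),
      congr_left (s z) (show f (s x + s y) = f (s (x + y)) by rw [map_add, hs, hs, hs])]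
  · simpa only [hs _, braidCoboundary] using hch (s x) (s y)

theorem IsAbelianCocycle.isAbelianCoboundary_of_surjective (H : IsAbelianCocycle ω c)
    (hM : Module.Baer ℤ M) (hf : Function.Surjective f)
    (HG : IsAbelianCoboundary (fun x y z => ω (f x) (f y) (f z)) fun x y => c (f x) (f y)) :
    IsAbelianCoboundary ω c := by
  obtain ⟨g, hg⟩ := H.exists_isNormalized
  have HG' := HG.sub_coboundary fun x y => g (f x) (f y)
  refine .of_sub_coboundary g ?_
  obtain ⟨h, hωh, hch⟩ : IsAbelianCoboundary
      (fun x y z => (ω - assocCoboundary g) (f x) (f y) (f z))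
      (fun x y => (c - braidCoboundary g) (f x) (f y)) := by
    convert HG' using 1
    · ext x y z
      simp [assocCoboundary]
    · rfl
  obtain ⟨Ψ, hΨ⟩ :=
    (H.sub_coboundary g).exists_cohomologous_vanishing_on_ker hM hg hf hωh hch
  exact isAbelianCoboundary_of_vanishing_on_ker hg hf
    (fun x y z => (hωh x y z).trans (assocCoboundary_eq_of_cohomologous h Ψ x y z).symm)
    (fun x y => (hch x y).trans (braidCoboundary_eq_of_cohomologous h Ψ x y).symm) hΨ

end Descent

namespace IsAbelianCocycle

theorem exists_isAbelianCoboundary_comp (H : IsAbelianCocycle ω c) (hc : ∀ x, c x x = 0)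
    (s : Finset A) : ∃ (G : Type) (_ : AddCommGroup G) (f : G →+ A),
      IsAbelianCoboundary (fun x y z => ω (f x) (f y) (f z)) (fun x y => c (f x) (f y)) ∧
        ∀ a ∈ s, a ∈ f.range := by
  classical
  induction s using Finset.induction_on with
  | empty => exact ⟨ℤ, inferInstance, 0, (H.comp 0).isAbelianCoboundary_int (by simp [hc]), by simp⟩
  | insert a s _ ih =>
    obtain ⟨G, _, f, hf, hs⟩ := ih
    refine ⟨G × ℤ, inferInstance, f.coprod (zmultiplesHom A a),
      H.isAbelianCoboundary_comp_coprod hc f (zmultiplesHom A a) hf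
        ((H.comp _).isAbelianCoboundary_int (by simp [hc])), fun b hb => ?_⟩
    rcases Finset.mem_insert.1 hb with rfl | hb
    · exact ⟨(0, 1), by simp⟩
    · obtain ⟨g, rfl⟩ := hs b hb
      exact ⟨(g, 0), by simp⟩

/-- The theorem of Eilenberg and Mac Lane: the quadratic form `x ↦ c x x` determines an abelian
cocycle up to coboundaries. -/
theorem isAbelianCoboundary [AddGroup.FG A] (H : IsAbelianCocycle ω c) (hM : Module.Baer ℤ M)
    (hc : ∀ x, c x x = 0) : IsAbelianCoboundary ω c := by
  obtain ⟨s, hs⟩ := AddGroup.fg_def.1 ‹AddGroup.FG A›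
  obtain ⟨G, _, f, hf, hfs⟩ := H.exists_isAbelianCoboundary_comp hc s
  have hsurj : Function.Surjective f := by
    rw [← AddMonoidHom.range_eq_top, eq_top_iff, ← hs, AddSubgroup.closure_le]
    exact hfs
  exact H.isAbelianCoboundary_of_surjective hM hsurj hf

end IsAbelianCocycle

theorem baer_additive_units (k : Type*) [Field k] [IsAlgClosed k] :
    Module.Baer ℤ (Additive kˣ) := by
  have pow_surjective : ∀ {n : ℕ}, n ≠ 0 → Function.Surjective fun a : kˣ => a ^ n := by
    intro n hn a
    obtain ⟨z, hz⟩ := IsAlgClosed.exists_pow_nat_eq (a : k) (Nat.pos_of_ne_zero hn)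
    have hz0 : z ≠ 0 := (pow_ne_zero_iff hn).1 (hz ▸ a.ne_zero)
    exact ⟨Units.mk0 z hz0, Units.ext (by simpa using hz)⟩
  let : DivisibleBy (Additive kˣ) ℕ :=
    divisibleByOfSMulRightSurj _ _ fun {n} hn a =>
      (pow_surjective hn a.toMul).imp fun _ hb => congrArg Additive.ofMul hb
  let : DivisibleBy (Additive kˣ) ℤ := AddGroup.divisibleByIntOfDivisibleByNat _
  exact Module.Baer.of_divisible _

end AbelianCocycles

/-! ### Direct sum decompositions -/

section Decomposition

universe w v u v' u'

/-- Morphisms exhibiting the object `X` as a finite direct sum of the objects `F j`. (Unlike in a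
bilimit bicone, no decidable equality of indices is involved.) -/
structure Decomposition {C : Type u} [Category.{v} C] [Preadditive C] {J : Type*} [Fintype J]
    (F : J → C) (X : C) where
  ι : ∀ j, F j ⟶ X
  π : ∀ j, X ⟶ F j
  ι_π : ∀ j, ι j ≫ π j = 𝟙 (F j)
  ι_π_ne : ∀ i j, i ≠ j → ι i ≫ π j = 0
  total : ∑ j, π j ≫ ι j = 𝟙 X

namespace Decomposition

variable {C : Type u} [Category.{v} C] [Preadditive C] {J : Type*} [Fintype J] {F : J → C} {X : C}

theorem hom_ext (d : Decomposition F X) {Y : C} {f g : X ⟶ Y}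
    (h : ∀ j, d.ι j ≫ f = d.ι j ≫ g) : f = g := by
  rw [← Category.id_comp f, ← Category.id_comp g, ← d.total, Preadditive.sum_comp,
    Preadditive.sum_comp]
  exact Finset.sum_congr rfl fun j _ => by rw [Category.assoc, Category.assoc, h]

/-- The morphism from a direct sum with given restrictions to the summands. -/
def desc (d : Decomposition F X) {Y : C} (f : ∀ j, F j ⟶ Y) : X ⟶ Y := ∑ j, d.π j ≫ f j

/-- The morphism to a direct sum with given components. -/
def lift (d : Decomposition F X) {Y : C} (f : ∀ j, Y ⟶ F j) : Y ⟶ X := ∑ j, f j ≫ d.ι j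

theorem ι_desc (d : Decomposition F X) {Y : C} (f : ∀ j, F j ⟶ Y) (j : J) :
    d.ι j ≫ d.desc f = f j := by
  rw [desc, Preadditive.comp_sum, Finset.sum_eq_single j]
  · rw [reassoc_of% (d.ι_π j)]
  · intro l _ hl
    rw [reassoc_of% (d.ι_π_ne j l hl.symm), zero_comp]
  · simp

theorem lift_π (d : Decomposition F X) {Y : C} (f : ∀ j, Y ⟶ F j) (j : J) :
    d.lift f ≫ d.π j = f j := by
  rw [lift, Preadditive.sum_comp, Finset.sum_eq_single j]
  · rw [Category.assoc, d.ι_π, Category.comp_id]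
  · intro l _ hl
    rw [Category.assoc, d.ι_π_ne l j hl, comp_zero]
  · simp

/-- Replace the summands by isomorphic ones. -/
def congr (d : Decomposition F X) {G : J → C} (e : ∀ j, F j ≅ G j) : Decomposition G X where
  ι j := (e j).inv ≫ d.ι j
  π j := d.π j ≫ (e j).hom
  ι_π j := by simp [reassoc_of% (d.ι_π j)]
  ι_π_ne i j h := by simp [reassoc_of% (d.ι_π_ne i j h)]
  total := by simp [d.total]

/-- Replace the sum by an isomorphic object. -/
def congrRight (d : Decomposition F X) {Y : C} (e : X ≅ Y) : Decomposition F Y where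
  ι j := d.ι j ≫ e.hom
  π j := e.inv ≫ d.π j
  ι_π j := by simp [d.ι_π j]
  ι_π_ne i j h := by simp [d.ι_π_ne i j h]
  total := by
    have : ∀ j, (e.inv ≫ d.π j) ≫ d.ι j ≫ e.hom = e.inv ≫ (d.π j ≫ d.ι j) ≫ e.hom := by simp
    simp only [this, ← Preadditive.comp_sum, ← Preadditive.sum_comp, d.total]
    simp

/-- Reindex a direct sum. -/
def reindex (d : Decomposition F X) {J' : Type*} [Fintype J'] (e : J' ≃ J) :
    Decomposition (fun j => F (e j)) X where
  ι j := d.ι (e j)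
  π j := d.π (e j)
  ι_π j := d.ι_π (e j)
  ι_π_ne i j h := d.ι_π_ne _ _ (e.injective.ne h)
  total := by rw [← d.total]; exact e.sum_comp (fun j => d.π j ≫ d.ι j)

/-- A direct sum of direct sums. -/
def sigma (d : Decomposition F X) {K : J → Type*} [∀ j, Fintype (K j)] {G : ∀ j, K j → C}
    (e : ∀ j, Decomposition (G j) (F j)) : Decomposition (fun p : Σ j, K j => G p.1 p.2) X where
  ι p := (e p.1).ι p.2 ≫ d.ι p.1
  π p := d.π p.1 ≫ (e p.1).π p.2
  ι_π p := by simp [reassoc_of% (d.ι_π p.1), (e p.1).ι_π]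
  ι_π_ne := by
    rintro ⟨i, a⟩ ⟨j, b⟩ h
    rcases eq_or_ne i j with rfl | hij
    · have hab : a ≠ b := fun h' => h (by rw [h'])
      simp [reassoc_of% (d.ι_π i), (e i).ι_π_ne a b hab]
    · simp [reassoc_of% (d.ι_π_ne i j hij)]
  total := by
    rw [← Finset.univ_sigma_univ, Finset.sum_sigma, ← d.total]
    refine Finset.sum_congr rfl fun j _ => ?_
    have : ∀ x, (d.π j ≫ (e j).π x) ≫ (e j).ι x ≫ d.ι j =
        d.π j ≫ ((e j).π x ≫ (e j).ι x) ≫ d.ι j := by simp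
    simp only [this, ← Preadditive.comp_sum, ← Preadditive.sum_comp, (e j).total]
    simp

/-- The image of a direct sum under an additive functor. -/
def map (d : Decomposition F X) {D : Type u'} [Category.{v'} D] [Preadditive D] (G : C ⥤ D)
    [G.Additive] : Decomposition (fun j => G.obj (F j)) (G.obj X) where
  ι j := G.map (d.ι j)
  π j := G.map (d.π j)
  ι_π j := by rw [← G.map_comp, d.ι_π, G.map_id]
  ι_π_ne i j h := by rw [← G.map_comp, d.ι_π_ne i j h, G.map_zero]
  total := by simp only [← G.map_comp, ← G.map_sum, d.total, G.map_id]

/-- The direct sum provided by a bilimit bicone. -/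
def ofBicone (b : Bicone F) (hb : b.IsBilimit) : Decomposition F b.pt where
  ι := b.ι
  π := b.π
  ι_π j := by simp
  ι_π_ne i j h := by rw [b.ι_π, dif_neg h]
  total := by
    classical
    exact IsBilimit.total hb

variable [DecidableEq J] in
/-- The bicone of a direct sum. -/
def bicone (d : Decomposition F X) : Bicone F where
  pt := X
  ι := d.ι
  π := d.π
  ι_π i j := by
    split_ifs with h
    · subst h
      simpa using d.ι_π i
    · exact d.ι_π_ne i j h

variable [DecidableEq J] in
/-- The bicone of a direct sum is a bilimit. -/
def isBilimit (d : Decomposition F X) : d.bicone.IsBilimit := isBilimitOfTotal _ d.total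

/-- Morphisms to a direct sum are families of morphisms to the summands. -/
def homEquiv (k : Type w) [Field k] [Linear k C] (d : Decomposition F X) (Y : C) :
    (Y ⟶ X) ≃ₗ[k] ∀ j, Y ⟶ F j where
  toFun f j := f ≫ d.π j
  map_add' f g := by ext; simp
  map_smul' c f := by ext; simp
  invFun := d.lift
  left_inv f := by simp [lift, ← Preadditive.comp_sum, d.total]
  right_inv g := funext (d.lift_π g)

end Decomposition

end Decomposition

/-! ### Categories with a basis of simple objects -/

section SimpleBasis

universe w v u v' u' uI

/-- The objects `S i` are simple, pairwise non-isomorphic, with scalar endomorphisms, and every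
object is a direct sum of them. -/
structure IsSimpleBasis (k : Type w) [Field k] {C : Type u} [Category.{v} C] [Preadditive C]
    [Linear k C] {I : Type uI} (S : I → C) : Prop where
  id_ne_zero : ∀ i, 𝟙 (S i) ≠ 0
  schur : ∀ i (f : S i ⟶ S i), ∃ c : k, f = c • 𝟙 (S i)
  homOrthogonal : HomOrthogonal S
  exists_decomposition :
    ∀ X, ∃ (n : ℕ) (s : Fin n → I), Nonempty (Decomposition (fun j => S (s j)) X)

namespace IsSimpleBasis

variable {k : Type w} [Field k] {C : Type u} [Category.{v} C] [Preadditive C] [Linear k C]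
  {I : Type uI} {S : I → C}

theorem hom_induction (H : IsSimpleBasis k S) {i j : I} (f : S i ⟶ S j)
    {P : ∀ {i j : I}, (S i ⟶ S j) → Prop} (h0 : ∀ i j, P (0 : S i ⟶ S j))
    (h1 : ∀ i (c : k), P (c • 𝟙 (S i))) : P f := by
  rcases eq_or_ne i j with rfl | h
  · obtain ⟨c, rfl⟩ := H.schur i f
    exact h1 i c
  · rw [H.homOrthogonal.eq_zero h f]
    exact h0 i j

variable {D : Type u'} [Category.{v'} D] [Preadditive D]

theorem hom_ext_map (H : IsSimpleBasis k S) (G : C ⥤ D) [G.Additive] {X : C} {Z : D}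
    {f g : G.obj X ⟶ Z} (h : ∀ i (u : S i ⟶ X), G.map u ≫ f = G.map u ≫ g) : f = g := by
  obtain ⟨n, s, ⟨d⟩⟩ := H.exists_decomposition X
  exact (d.map G).hom_ext fun j => h _ (d.ι j)

theorem hom_ext (H : IsSimpleBasis k S) {X Z : C} {f g : X ⟶ Z}
    (h : ∀ i (u : S i ⟶ X), u ≫ f = u ≫ g) : f = g :=
  H.hom_ext_map (𝟭 C) h

theorem natTrans_ext (H : IsSimpleBasis k S) {G G' : C ⥤ D} [G.Additive] {t t' : G ⟶ G'}
    (h : ∀ i, t.app (S i) = t'.app (S i)) : t = t' := by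
  ext X
  refine H.hom_ext_map G fun i u => ?_
  rw [t.naturality, t'.naturality, h]

theorem exists_natTrans [Linear k D] (H : IsSimpleBasis k S) (G G' : C ⥤ D) [G.Additive]
    [G'.Additive] [G.Linear k] [G'.Linear k] (t : ∀ i, G.obj (S i) ⟶ G'.obj (S i)) :
    ∃ T : G ⟶ G', ∀ i, T.app (S i) = t i := by
  have nat : ∀ {i j : I} (f : S i ⟶ S j), G.map f ≫ t j = t i ≫ G'.map f := fun f =>
    H.hom_induction f (P := fun {i j} f => G.map f ≫ t j = t i ≫ G'.map f) (by simp)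
      (by simp [Functor.map_smul])
  choose n s d using H.exists_decomposition
  replace d := fun X => (d X).some
  let T : ∀ X, G.obj X ⟶ G'.obj X := fun X =>
    ∑ j, G.map ((d X).π j) ≫ t (s X j) ≫ G'.map ((d X).ι j)
  have hT : ∀ X i (u : S i ⟶ X), G.map u ≫ T X = t i ≫ G'.map u := by
    intro X i u
    have h1 : ∀ j, G.map u ≫ G.map ((d X).π j) ≫ t (s X j) ≫ G'.map ((d X).ι j) =
        t i ≫ G'.map u ≫ G'.map ((d X).π j ≫ (d X).ι j) := by
      intro j
      rw [← G.map_comp_assoc, reassoc_of% (nat (u ≫ (d X).π j)), ← G'.map_comp, ← G'.map_comp,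
        Category.assoc]
    simp only [T, Preadditive.comp_sum, h1]
    rw [← Preadditive.comp_sum, ← Preadditive.comp_sum, ← G'.map_sum, (d X).total]
    simp
  refine ⟨{ app := T, naturality := fun X Y f => ?_ }, fun i => ?_⟩
  · refine H.hom_ext_map G fun i u => ?_
    rw [← G.map_comp_assoc, hT, reassoc_of% (hT X i u), G'.map_comp]
  · simpa using hT (S i) i (𝟙 _)

theorem exists_natIso [Linear k D] (H : IsSimpleBasis k S) (G G' : C ⥤ D) [G.Additive]
    [G'.Additive] [G.Linear k] [G'.Linear k] (t : ∀ i, G.obj (S i) ≅ G'.obj (S i)) :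
    ∃ T : G ≅ G', ∀ i, T.hom.app (S i) = (t i).hom := by
  obtain ⟨T, hT⟩ := H.exists_natTrans G G' fun i => (t i).hom
  obtain ⟨T', hT'⟩ := H.exists_natTrans G' G fun i => (t i).inv
  exact ⟨⟨T, T', H.natTrans_ext (by simp [hT, hT']), H.natTrans_ext (by simp [hT, hT'])⟩, hT⟩

theorem simple (H : IsSimpleBasis k S) (i : I) : Simple (S i) where
  mono_isIso_iff_nonzero {Y} f _ := by
    refine ⟨fun _ h => H.id_ne_zero i ?_, fun hf => ?_⟩
    · rw [← IsIso.inv_hom_id f, ← comp_zero (f := inv f) (Z := S i), ← h]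
    · obtain ⟨j, u, hu⟩ : ∃ j, ∃ u : S j ⟶ Y, u ≫ f ≠ 0 := by
        by_contra! h
        exact hf (H.hom_ext fun j u => by rw [h, comp_zero])
      have hj : j = i := by
        by_contra hj
        exact hu (H.homOrthogonal.eq_zero hj _)
      subst hj
      obtain ⟨c, hc⟩ := H.schur j (u ≫ f)
      have hc0 : c ≠ 0 := by
        rintro rfl
        exact hu (by rw [hc, zero_smul])
      have : IsSplitEpi f := ⟨⟨⟨c⁻¹ • u, by rw [Linear.smul_comp, hc, smul_smul,
        inv_mul_cancel₀ hc0, one_smul]⟩⟩⟩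
      exact isIso_of_mono_of_isSplitEpi f

theorem exists_iso_of_simple (H : IsSimpleBasis k S) (X : C) [Simple X] :
    ∃ i, Nonempty (X ≅ S i) := by
  obtain ⟨n, s, ⟨d⟩⟩ := H.exists_decomposition X
  rcases n.eq_zero_or_pos with rfl | hn
  · exact absurd (by simpa using d.total.symm) (id_nonzero X)
  · have : IsSplitMono (d.ι ⟨0, hn⟩) := ⟨⟨⟨d.π ⟨0, hn⟩, d.ι_π _⟩⟩⟩
    have : IsIso (d.ι ⟨0, hn⟩) := isIso_of_mono_of_nonzero fun h =>
      H.id_ne_zero (s ⟨0, hn⟩) (by rw [← d.ι_π, h, zero_comp])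
    exact ⟨_, ⟨(asIso (d.ι ⟨0, hn⟩)).symm⟩⟩

theorem eq_of_iso (H : IsSimpleBasis k S) {i j : I} (e : S i ≅ S j) : i = j := by
  by_contra h
  exact H.id_ne_zero i (by rw [← e.hom_inv_id, H.homOrthogonal.eq_zero h e.hom, zero_comp])

theorem finrank_hom (H : IsSimpleBasis k S) [DecidableEq I] (i j : I) :
    Module.finrank k (S i ⟶ S j) = if i = j then 1 else 0 := by
  split_ifs with h
  · subst h
    exact finrank_eq_one _ (H.id_ne_zero i) fun f => (H.schur i f).imp fun _ h => h.symm
  · have := H.homOrthogonal h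
    exact Module.finrank_zero_of_subsingleton

theorem finite_hom_basis (H : IsSimpleBasis k S) (i j : I) : Module.Finite k (S i ⟶ S j) := by
  rcases eq_or_ne i j with rfl | h
  · exact Module.Finite.of_surjective (LinearMap.toSpanSingleton k _ (𝟙 (S i)))
      fun f => (H.schur i f).imp fun _ h => h.symm
  · have := H.homOrthogonal h
    infer_instance

theorem finite_hom_left (H : IsSimpleBasis k S) (i : I) (X : C) : Module.Finite k (S i ⟶ X) := by
  obtain ⟨n, s, ⟨d⟩⟩ := H.exists_decomposition X
  have := fun j => H.finite_hom_basis i (s j)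
  exact Module.Finite.equiv (d.homEquiv k (S i)).symm

theorem finite_hom (H : IsSimpleBasis k S) (X Y : C) : Module.Finite k (X ⟶ Y) := by
  obtain ⟨n, s, ⟨d⟩⟩ := H.exists_decomposition X
  have := fun j => H.finite_hom_left (s j) Y
  let f : (X ⟶ Y) →ₗ[k] ∀ j, S (s j) ⟶ Y :=
    { toFun := fun g j => d.ι j ≫ g
      map_add' := by intros; ext; simp
      map_smul' := by intros; ext; simp }
  exact Module.Finite.of_injective f fun _ _ h => d.hom_ext (congrFun h)

theorem finrank_hom_decomposition (H : IsSimpleBasis k S) [DecidableEq I] {J : Type*} [Fintype J]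
    {s : J → I} {X : C} (d : Decomposition (fun j => S (s j)) X) (i : I) :
    Module.finrank k (S i ⟶ X) = Fintype.card {j // s j = i} := by
  have := fun j => H.finite_hom_basis i (s j)
  rw [(d.homEquiv k (S i)).finrank_eq, Module.finrank_pi_fintype, Fintype.card_subtype,
    Finset.card_filter]
  exact Finset.sum_congr rfl fun j _ => by rw [H.finrank_hom]; simp [eq_comm]

/-- The functor sending an object to its multiplicity spaces. -/
def multiplicity (H : IsSimpleBasis k S) : C ⥤ Discrete I ⥤ FGModuleCat.{max v v'} k where
  obj X := Discrete.functor fun i =>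
    have := H.finite_hom_left i X
    FGModuleCat.of k (ULift.{v'} (S i ⟶ X))
  map {X Y} f := Discrete.natTrans fun i =>
    have := H.finite_hom_left i.as X
    have := H.finite_hom_left i.as Y
    FGModuleCat.ofHom (ULift.moduleEquiv.symm.toLinearMap ∘ₗ (Linear.rightComp k (S i.as) f) ∘ₗ
      ULift.moduleEquiv.toLinearMap)
  map_id X := by
    ext i u
    exact ULift.ext _ _ (Category.comp_id u.down)
  map_comp f g := by
    ext i u
    exact ULift.ext _ _ (Category.assoc u.down f g).symm

theorem multiplicity_map_apply (H : IsSimpleBasis k S) {X Y : C} (f : X ⟶ Y) (i : I)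
    (u : S i ⟶ X) :
    ((H.multiplicity.{w, v, u, v'}.map f).app ⟨i⟩).hom.hom (ULift.up u) = ULift.up (u ≫ f) := rfl

instance (H : IsSimpleBasis k S) : H.multiplicity.{w, v, u, v'}.Additive where
  map_add {X Y f g} := by
    ext i u
    exact ULift.ext _ _ (Preadditive.comp_add _ _ _ u.down f g)

instance (H : IsSimpleBasis k S) : H.multiplicity.{w, v, u, v'}.Linear k where
  map_smul f c := by
    ext i u
    exact ULift.ext _ _ (Linear.comp_smul _ _ _ u.down c f)

instance (H : IsSimpleBasis k S) : H.multiplicity.{w, v, u, v'}.Faithful where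
  map_injective {X Y f g} h := H.hom_ext fun i u => ULift.up_injective (by
    rw [← H.multiplicity_map_apply.{w, v, u, v'} f, ← H.multiplicity_map_apply.{w, v, u, v'} g, h])

instance (H : IsSimpleBasis k S) : H.multiplicity.{w, v, u, v'}.Full where
  map_surjective {X Y} T := by
    obtain ⟨n, s, ⟨d⟩⟩ := H.exists_decomposition X
    let t : ∀ i, (S i ⟶ X) →ₗ[k] (S i ⟶ Y) := fun i =>
      ULift.moduleEquiv.toLinearMap ∘ₗ (T.app ⟨i⟩).hom.hom ∘ₗ ULift.moduleEquiv.symm.toLinearMap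
    have ht : ∀ {i j : I} (f : S i ⟶ S j) (u : S j ⟶ X), t i (f ≫ u) = f ≫ t j u := fun f =>
      H.hom_induction f (P := fun {i j} f => ∀ u, t i (f ≫ u) = f ≫ t j u) (by simp) (by simp)
    refine ⟨∑ j, d.π j ≫ t (s j) (d.ι j), ?_⟩
    ext ⟨i⟩ u
    refine ULift.ext _ _ (?_ : u.down ≫ (∑ j, d.π j ≫ t (s j) (d.ι j)) = t i u.down)
    conv_rhs => rw [← Category.comp_id u.down, ← d.total, Preadditive.comp_sum, map_sum]
    simp only [← Category.assoc, ht, Preadditive.comp_sum]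

variable [HasFiniteBiproducts C] [Finite I]

instance (H : IsSimpleBasis k S) : H.multiplicity.{w, v, u, v'}.EssSurj where
  mem_essImage M := by
    classical
    have := Fintype.ofFinite I
    let F : (Σ i : I, Fin (Module.finrank k (M.obj ⟨i⟩))) → C := fun p => S p.1
    let d : Decomposition F (⨁ F) := Decomposition.ofBicone _ (biproduct.isBilimit F)
    refine ⟨⨁ F, ⟨Discrete.natIso fun i => ?_⟩⟩
    have := H.finite_hom_left i.as (⨁ F)
    refine (LinearEquiv.ofFinrankEq (ULift.{v'} (S i.as ⟶ ⨁ F)) (M.obj i) ?_).toFGModuleCatIso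
    rw [LinearEquiv.finrank_eq ULift.moduleEquiv, H.finrank_hom_decomposition d]
    rw [Fintype.card_congr (Equiv.sigmaSubtype i.as), Fintype.card_fin]

instance (H : IsSimpleBasis k S) : H.multiplicity.{w, v, u, v'}.IsEquivalence where

theorem isAbelian (H : IsSimpleBasis k S) : IsAbelian C := by
  have : HasFiniteProducts C := inferInstance
  let _ : Abelian C := abelianOfEquivalence H.multiplicity.{w, v, u, v}
  exact ⟨inferInstance, inferInstance, inferInstance, inferInstance, inferInstance⟩

theorem isFusionCategory [MonoidalCategory C] [MonoidalPreadditive C] [MonoidalLinear k C]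
    (H : IsSimpleBasis k S) (hr : Nonempty (RigidCategory C)) (i : I)
    (hi : Nonempty (𝟙_ C ≅ S i)) : IsFusionCategory k C where
  isAbelian := H.isAbelian
  rigid := hr
  finiteDimensional_hom := H.finite_hom
  simple_unit := by
    obtain ⟨e⟩ := hi
    have := H.simple i
    exact Simple.of_iso e
  finite_simples := by
    obtain ⟨n, ⟨e⟩⟩ := Finite.exists_equiv_fin I
    refine ⟨n, fun j => S (e.symm j), fun X _ => ?_⟩
    obtain ⟨i, hi⟩ := H.exists_iso_of_simple X
    exact ⟨e i, by simpa using hi⟩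
  semisimple X := by
    obtain ⟨n, s, ⟨d⟩⟩ := H.exists_decomposition X
    exact ⟨n, fun j => S (s j), d.bicone, fun j => H.simple _, ⟨d.isBilimit⟩, ⟨Iso.refl _⟩⟩

theorem exists_equivalence [Linear k D] [HasFiniteBiproducts D] {T : I → D}
    (H : IsSimpleBasis k S) (H' : IsSimpleBasis k T) :
    ∃ F : C ⥤ D, F.IsEquivalence ∧ F.Additive ∧ F.Linear k ∧ ∀ i, Nonempty (F.obj (S i) ≅ T i) := by
  let V := H.multiplicity.{w, v, u, v'}
  let V' := H'.multiplicity.{w, v', u', v}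
  have : V'.asEquivalence.functor.Additive := inferInstanceAs V'.Additive
  have : V'.asEquivalence.functor.Linear k := inferInstanceAs (V'.Linear k)
  have : V'.asEquivalence.inverse.Linear k := Equivalence.inverseLinear k V'.asEquivalence
  refine ⟨V ⋙ V'.asEquivalence.inverse, inferInstance, inferInstance, inferInstance,
    fun i => ⟨V'.preimageIso (V'.asEquivalence.counitIso.app (V.obj (S i)) ≪≫
      Discrete.natIso fun j => ?_)⟩⟩
  classical
  have := H.finite_hom_left j.as (S i)
  have := H'.finite_hom_left j.as (T i)
  refine (LinearEquiv.ofFinrankEq (ULift.{v'} (S j.as ⟶ S i))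
    (ULift.{v} (T j.as ⟶ T i)) ?_).toFGModuleCatIso
  rw [LinearEquiv.finrank_eq ULift.moduleEquiv, LinearEquiv.finrank_eq ULift.moduleEquiv,
    H.finrank_hom, H'.finrank_hom]

end IsSimpleBasis

theorem IsFusionCategory.isSimpleBasis {k : Type w} [Field k] [IsAlgClosed k] {C : Type u}
    [Category.{v} C] [Preadditive C] [Linear k C] [MonoidalCategory C] [MonoidalPreadditive C]
    [MonoidalLinear k C] (hC : IsFusionCategory k C) {I : Type uI} (S : I → C)
    (hS : ∀ i, Simple (S i)) (hS' : ∀ X : C, Simple X → ∃ i, Nonempty (X ≅ S i))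
    (hinj : ∀ i j, Nonempty (S i ≅ S j) → i = j) : IsSimpleBasis k S where
  id_ne_zero i := id_nonzero (S i)
  schur i f := by
    have := hC.isAbelian.hasKernels
    have := hC.finiteDimensional_hom
    obtain ⟨c, hc⟩ := endomorphism_simple_eq_smul_id k f
    exact ⟨c, hc.symm⟩
  homOrthogonal i j h := by
    have := hC.isAbelian.hasKernels
    refine subsingleton_of_forall_eq 0 fun f => ?_
    by_contra hf
    have := isIso_of_hom_simple hf
    exact h (hinj i j ⟨asIso f⟩)
  exists_decomposition X := by
    obtain ⟨n, T, b, hT, ⟨hb⟩, ⟨e⟩⟩ := hC.semisimple X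
    choose s hs using fun j => hS' (T j) (hT j)
    exact ⟨n, s, ⟨((Decomposition.ofBicone b hb).congr fun j => (hs j).some).congrRight e.symm⟩⟩

end SimpleBasis

/-! ### Braided functors on categories with a basis of simple objects -/

section Tensorator

universe w v u v' u' uA

variable {C : Type u} [Category.{v} C] [MonoidalCategory C]
  {D : Type u'} [Category.{v'} D] [MonoidalCategory D]

/-- A natural isomorphism `F X ⊗ F Y ≅ F (X ⊗ Y)`, without any coherence condition. -/
structure Tensorator (F : C ⥤ D) where
  μ : ∀ X Y, F.obj X ⊗ F.obj Y ≅ F.obj (X ⊗ Y)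
  naturality_left : ∀ {X X' : C} (f : X ⟶ X') (Y : C),
    F.map f ▷ F.obj Y ≫ (μ X' Y).hom = (μ X Y).hom ≫ F.map (f ▷ Y)
  naturality_right : ∀ (X : C) {Y Y' : C} (f : Y ⟶ Y'),
    F.obj X ◁ F.map f ≫ (μ X Y').hom = (μ X Y).hom ≫ F.map (X ◁ f)

namespace Tensorator

variable {F : C ⥤ D} (t : Tensorator F)

/-- The composite `(F X ⊗ F Y) ⊗ F Z ⟶ F ((X ⊗ Y) ⊗ Z) ⟶ F (X ⊗ (Y ⊗ Z))`. -/
def assocLeft (X Y Z : C) : (F.obj X ⊗ F.obj Y) ⊗ F.obj Z ≅ F.obj (X ⊗ Y ⊗ Z) :=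
  whiskerRightIso (t.μ X Y) (F.obj Z) ≪≫ t.μ (X ⊗ Y) Z ≪≫ F.mapIso (α_ X Y Z)

/-- The composite `(F X ⊗ F Y) ⊗ F Z ⟶ F X ⊗ (F Y ⊗ F Z) ⟶ F (X ⊗ (Y ⊗ Z))`. -/
def assocRight (X Y Z : C) : (F.obj X ⊗ F.obj Y) ⊗ F.obj Z ≅ F.obj (X ⊗ Y ⊗ Z) :=
  α_ _ _ _ ≪≫ whiskerLeftIso (F.obj X) (t.μ Y Z) ≪≫ t.μ X (Y ⊗ Z)

theorem assocLeft_hom (X Y Z : C) : (t.assocLeft X Y Z).hom =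
    (t.μ X Y).hom ▷ F.obj Z ≫ (t.μ (X ⊗ Y) Z).hom ≫ F.map (α_ X Y Z).hom := rfl

theorem assocRight_hom (X Y Z : C) : (t.assocRight X Y Z).hom =
    (α_ _ _ _).hom ≫ F.obj X ◁ (t.μ Y Z).hom ≫ (t.μ X (Y ⊗ Z)).hom := rfl

theorem naturality {X X' Y Y' : C} (f : X ⟶ X') (g : Y ⟶ Y') :
    (F.map f ⊗ₘ F.map g) ≫ (t.μ X' Y').hom = (t.μ X Y).hom ≫ F.map (f ⊗ₘ g) := by
  rw [MonoidalCategory.tensorHom_def, MonoidalCategory.tensorHom_def, Category.assoc,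
    t.naturality_right, reassoc_of% t.naturality_left, F.map_comp]

theorem assocLeft_naturality {X X' Y Y' Z Z' : C} (f : X ⟶ X') (g : Y ⟶ Y') (h : Z ⟶ Z') :
    ((F.map f ⊗ₘ F.map g) ⊗ₘ F.map h) ≫ (t.assocLeft X' Y' Z').hom =
      (t.assocLeft X Y Z).hom ≫ F.map (f ⊗ₘ g ⊗ₘ h) := by
  rw [assocLeft_hom, assocLeft_hom, ← tensorHom_id, tensorHom_comp_tensorHom_assoc, naturality,
    Category.comp_id, ← whiskerRight_comp_tensorHom, Category.assoc, reassoc_of% t.naturality,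
    ← F.map_comp, associator_naturality]
  simp only [Category.assoc, F.map_comp]

theorem assocRight_naturality {X X' Y Y' Z Z' : C} (f : X ⟶ X') (g : Y ⟶ Y') (h : Z ⟶ Z') :
    ((F.map f ⊗ₘ F.map g) ⊗ₘ F.map h) ≫ (t.assocRight X' Y' Z').hom =
      (t.assocRight X Y Z).hom ≫ F.map (f ⊗ₘ g ⊗ₘ h) := by
  rw [assocRight_hom, assocRight_hom, associator_naturality_assoc, ← id_tensorHom,
    tensorHom_comp_tensorHom_assoc, naturality, Category.comp_id, ← whiskerLeft_comp_tensorHom,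
    Category.assoc, naturality]
  simp only [Category.assoc]

theorem left_unitality (e : 𝟙_ D ≅ F.obj (𝟙_ C))
    (he : (e.hom ▷ F.obj (𝟙_ C)) ≫ (t.μ (𝟙_ C) (𝟙_ C)).hom ≫ F.map (λ_ (𝟙_ C)).hom =
      (λ_ (F.obj (𝟙_ C))).hom)
    (hα : ∀ X Y Z, (t.assocLeft X Y Z).hom = (t.assocRight X Y Z).hom) (X : C) :
    (e.hom ▷ F.obj X) ≫ (t.μ (𝟙_ C) X).hom ≫ F.map (λ_ X).hom = (λ_ (F.obj X)).hom := by
  have he' : (e.hom ▷ F.obj (𝟙_ C)) ≫ (t.μ (𝟙_ C) (𝟙_ C)).hom =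
      (λ_ (F.obj (𝟙_ C))).hom ≫ F.map (λ_ (𝟙_ C)).inv := by
    rw [← he]
    simp
  have unitality_tensor : (e.hom ▷ F.obj (𝟙_ C ⊗ X)) ≫ (t.μ (𝟙_ C) (𝟙_ C ⊗ X)).hom =
      (λ_ (F.obj (𝟙_ C ⊗ X))).hom ≫ F.map (λ_ (𝟙_ C ⊗ X)).inv := by
    have e1 : ((e.hom ▷ F.obj (𝟙_ C)) ▷ F.obj X) ≫ (t.assocLeft (𝟙_ C) (𝟙_ C) X).hom =
        (α_ _ _ _).hom ≫ (𝟙_ D ◁ (t.μ (𝟙_ C) X).hom) ≫ (λ_ (F.obj (𝟙_ C ⊗ X))).hom ≫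
          F.map (λ_ (𝟙_ C ⊗ X)).inv := by
      rw [assocLeft_hom, ← comp_whiskerRight_assoc, he', comp_whiskerRight_assoc,
        reassoc_of% t.naturality_left, ← F.map_comp, leftUnitor_naturality_assoc,
        leftUnitor_whiskerRight]
      simp
    rw [hα, assocRight_hom, associator_naturality_left_assoc, ← whisker_exchange_assoc] at e1
    exact (cancel_epi _).1 ((cancel_epi _).1 e1)
  have h_naturality : (𝟙_ D ◁ F.map (λ_ X).hom) ≫ (e.hom ▷ F.obj X) ≫ (t.μ (𝟙_ C) X).hom =
      (e.hom ▷ F.obj (𝟙_ C ⊗ X)) ≫ (t.μ (𝟙_ C) (𝟙_ C ⊗ X)).hom ≫ F.map (𝟙_ C ◁ (λ_ X).hom) := by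
    rw [whisker_exchange_assoc, t.naturality_right]
  rw [← cancel_epi (𝟙_ D ◁ F.map (λ_ X).hom), leftUnitor_naturality, reassoc_of% h_naturality,
    reassoc_of% unitality_tensor, ← F.map_comp, ← F.map_comp, leftUnitor_naturality,
    Iso.inv_hom_id_assoc]

section Braiding

/-- The composite `F X ⊗ F Y ⟶ F (X ⊗ Y) ⟶ F (Y ⊗ X)`. -/
def braidLeft [BraidedCategory C] (X Y : C) : F.obj X ⊗ F.obj Y ≅ F.obj (Y ⊗ X) :=
  t.μ X Y ≪≫ F.mapIso (β_ X Y)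

/-- The composite `F X ⊗ F Y ⟶ F Y ⊗ F X ⟶ F (Y ⊗ X)`. -/
def braidRight [BraidedCategory D] (X Y : C) : F.obj X ⊗ F.obj Y ≅ F.obj (Y ⊗ X) :=
  β_ _ _ ≪≫ t.μ Y X

theorem braidLeft_hom [BraidedCategory C] (X Y : C) :
    (t.braidLeft X Y).hom = (t.μ X Y).hom ≫ F.map (β_ X Y).hom := rfl

theorem braidRight_hom [BraidedCategory D] (X Y : C) :
    (t.braidRight X Y).hom = (β_ _ _).hom ≫ (t.μ Y X).hom := rfl

theorem braidLeft_naturality [BraidedCategory C] {X X' Y Y' : C} (f : X ⟶ X') (g : Y ⟶ Y') :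
    (F.map f ⊗ₘ F.map g) ≫ (t.braidLeft X' Y').hom =
      (t.braidLeft X Y).hom ≫ F.map (g ⊗ₘ f) := by
  rw [braidLeft_hom, braidLeft_hom, reassoc_of% t.naturality, Category.assoc, ← F.map_comp,
    ← F.map_comp, BraidedCategory.braiding_naturality]

theorem braidRight_naturality [BraidedCategory D] {X X' Y Y' : C} (f : X ⟶ X') (g : Y ⟶ Y') :
    (F.map f ⊗ₘ F.map g) ≫ (t.braidRight X' Y').hom =
      (t.braidRight X Y).hom ≫ F.map (g ⊗ₘ f) := by
  rw [braidRight_hom, braidRight_hom, BraidedCategory.braiding_naturality_assoc, t.naturality,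
    Category.assoc]

variable [BraidedCategory C] [BraidedCategory D]

theorem right_unitality (e : 𝟙_ D ≅ F.obj (𝟙_ C))
    (hl : ∀ X, (e.hom ▷ F.obj X) ≫ (t.μ (𝟙_ C) X).hom ≫ F.map (λ_ X).hom = (λ_ (F.obj X)).hom)
    (hβ : ∀ X Y, (t.braidLeft X Y).hom = (t.braidRight X Y).hom) (X : C) :
    (F.obj X ◁ e.hom) ≫ (t.μ X (𝟙_ C)).hom ≫ F.map (ρ_ X).hom = (ρ_ (F.obj X)).hom := by
  have hX := hβ X (𝟙_ C)
  rw [braidLeft_hom, braidRight_hom] at hX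
  rw [← braiding_leftUnitor, F.map_comp, reassoc_of% hX,
    BraidedCategory.braiding_naturality_right_assoc, hl, braiding_leftUnitor]

theorem nonempty_braided (e : 𝟙_ D ≅ F.obj (𝟙_ C))
    (he : (e.hom ▷ F.obj (𝟙_ C)) ≫ (t.μ (𝟙_ C) (𝟙_ C)).hom ≫ F.map (λ_ (𝟙_ C)).hom =
      (λ_ (F.obj (𝟙_ C))).hom)
    (hα : ∀ X Y Z, (t.assocLeft X Y Z).hom = (t.assocRight X Y Z).hom)
    (hβ : ∀ X Y, (t.braidLeft X Y).hom = (t.braidRight X Y).hom) : Nonempty F.Braided := by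
  have hl := t.left_unitality e he hα
  let core : F.CoreMonoidal :=
    { εIso := e
      μIso := t.μ
      μIso_hom_natural_left := fun f Y => t.naturality_left f Y
      μIso_hom_natural_right := fun X f => t.naturality_right X f
      associativity := hα
      left_unitality := fun X => (hl X).symm
      right_unitality := fun X => (t.right_unitality e hl hβ X).symm }
  let _ := core.toMonoidal
  exact ⟨{ braided := fun X Y => hβ X Y }⟩

end Braiding

section Linear

variable {k : Type w} [Field k] [Preadditive D] [Linear k D]

theorem exists_μ_eq [Preadditive C] [MonoidalPreadditive C] [Linear k C] [MonoidalLinear k C]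
    [MonoidalPreadditive D] [MonoidalLinear k D] {I : Type*} {S : I → C} (H : IsSimpleBasis k S)
    (F : C ⥤ D) [F.Additive] [F.Linear k]
    (K : ∀ a b, F.obj (S a) ⊗ F.obj (S b) ≅ F.obj (S a ⊗ S b)) :
    ∃ t : Tensorator F, ∀ a b, t.μ (S a) (S b) = K a b := by
  choose r hr using fun b =>
    H.exists_natIso (F ⋙ tensorRight (F.obj (S b))) (tensorRight (S b) ⋙ F) fun a => K a b
  -- The extensions in the first variable assemble to a natural family for the second one.
  choose l hl using fun X : C =>
    H.exists_natIso (F ⋙ tensorLeft (F.obj X)) (tensorLeft X ⋙ F) fun b => (r b).app X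
  refine ⟨⟨fun X Y => (l X).app Y, fun {X X'} f Y => ?_, fun X {Y Y'} f => (l X).hom.naturality f⟩,
    fun a b => Iso.ext ?_⟩
  · refine H.hom_ext_map (F ⋙ tensorLeft (F.obj X)) fun b u => ?_
    have l_naturality : ∀ X : C, (F.obj X ◁ F.map u) ≫ (l X).hom.app Y =
        (r b).hom.app X ≫ F.map (X ◁ u) := fun X => by
      have := (l X).hom.naturality u
      rw [hl] at this
      exact this
    have r_naturality : (F.map f ▷ F.obj (S b)) ≫ (r b).hom.app X' =
      (r b).hom.app X ≫ F.map (f ▷ S b) := (r b).hom.naturality f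
    change (F.obj X ◁ F.map u) ≫ (F.map f ▷ F.obj Y) ≫ (l X').hom.app Y =
      (F.obj X ◁ F.map u) ≫ (l X).hom.app Y ≫ F.map (f ▷ Y)
    rw [whisker_exchange_assoc, l_naturality, reassoc_of% r_naturality,
      reassoc_of% (l_naturality X), ← F.map_comp, ← F.map_comp, whisker_exchange]
  · exact (hl (S a) b).trans (hr b a)

variable (k) in
/-- The associativity of the tensorator holds on `X`, `Y`, `Z` up to the scalar `c`. -/
def AssocScalar (X Y Z : C) (c : kˣ) : Prop :=
  (t.assocLeft X Y Z).hom = (c : k) • (t.assocRight X Y Z).hom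

variable (k) in
/-- The compatibility of the tensorator with the braiding holds on `X`, `Y` up to the scalar `c`. -/
def BraidScalar [BraidedCategory C] [BraidedCategory D] (X Y : C) (c : kˣ) : Prop :=
  (t.braidLeft X Y).hom = (c : k) • (t.braidRight X Y).hom

variable {t}

theorem AssocScalar.of_iso {X X' Y Y' Z Z' : C} {c : kˣ}
    (h : t.AssocScalar k X Y Z c) (f : X ≅ X') (g : Y ≅ Y') (p : Z ≅ Z') :
    t.AssocScalar k X' Y' Z' c := by
  rw [AssocScalar] at h ⊢
  rw [← cancel_epi ((F.map f.hom ⊗ₘ F.map g.hom) ⊗ₘ F.map p.hom), t.assocLeft_naturality, h,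
    Linear.comp_smul, t.assocRight_naturality, Linear.smul_comp]

theorem AssocScalar.comp_map_associator_inv {X Y Z : C} {c : kˣ} (h : t.AssocScalar k X Y Z c) :
    (F.obj X ◁ (t.μ Y Z).hom) ≫ (t.μ X (Y ⊗ Z)).hom ≫ F.map (α_ X Y Z).inv =
      ((c⁻¹ : kˣ) : k) • ((α_ _ _ _).inv ≫ ((t.μ X Y).hom ▷ F.obj Z) ≫ (t.μ (X ⊗ Y) Z).hom) := by
  rw [AssocScalar, assocLeft_hom, assocRight_hom] at h
  rw [← cancel_mono (F.map (α_ X Y Z).hom), ← cancel_epi (α_ (F.obj X) (F.obj Y) (F.obj Z)).hom]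
  simp only [Linear.smul_comp, Linear.comp_smul, Category.assoc, ← F.map_comp, Iso.inv_hom_id,
    Iso.hom_inv_id_assoc, F.map_id, Category.comp_id, h, smul_smul, Units.inv_mul, one_smul]

variable (t) in
/-- The composite of the structure maps of `F` from `F X ⊗ F Y ⊗ F Z ⊗ F W`, bracketed to the left,
to `F (X ⊗ Y ⊗ Z ⊗ W)`, bracketed to the right, which rebrackets first. -/
def pentagonIso (X Y Z W : C) :
    ((F.obj X ⊗ F.obj Y) ⊗ F.obj Z) ⊗ F.obj W ≅ F.obj (X ⊗ Y ⊗ Z ⊗ W) :=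
  α_ _ _ _ ≪≫ α_ _ _ _ ≪≫ whiskerLeftIso _ (whiskerLeftIso _ (t.μ Z W)) ≪≫
    whiskerLeftIso _ (t.μ Y (Z ⊗ W)) ≪≫ t.μ X (Y ⊗ Z ⊗ W)

theorem AssocScalar.pentagon [MonoidalPreadditive D] [MonoidalLinear k D]
    {X Y Z W : C} {c₁ c₂ c₃ c₄ c₅ : kˣ}
    (h₁ : t.AssocScalar k X Y Z c₁) (h₂ : t.AssocScalar k X (Y ⊗ Z) W c₂)
    (h₃ : t.AssocScalar k Y Z W c₃) (h₄ : t.AssocScalar k (X ⊗ Y) Z W c₄)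
    (h₅ : t.AssocScalar k X Y (Z ⊗ W) c₅) :
    ((c₁ * c₂ * c₃ : kˣ) : k) • (t.pentagonIso X Y Z W).hom =
      ((c₄ * c₅ : kˣ) : k) • (t.pentagonIso X Y Z W).hom := by
  rw [AssocScalar, assocLeft_hom, assocRight_hom] at h₁ h₂ h₃ h₄ h₅
  trans ((t.μ X Y).hom ▷ F.obj Z ▷ F.obj W) ≫ ((t.μ (X ⊗ Y) Z).hom ▷ F.obj W) ≫
    (t.μ ((X ⊗ Y) ⊗ Z) W).hom ≫ F.map ((α_ X Y Z).hom ▷ W) ≫ F.map (α_ X (Y ⊗ Z) W).hom ≫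
      F.map (X ◁ (α_ Y Z W).hom)
  · have assoc_XYZ : ((t.μ X Y).hom ▷ F.obj Z ▷ F.obj W) ≫ ((t.μ (X ⊗ Y) Z).hom ▷ F.obj W) ≫
        (F.map (α_ X Y Z).hom ▷ F.obj W) = (c₁ : k) • (((α_ _ _ _).hom ▷ F.obj W) ≫
          ((F.obj X ◁ (t.μ Y Z).hom) ▷ F.obj W) ≫ ((t.μ X (Y ⊗ Z)).hom ▷ F.obj W)) := by
      simp only [← comp_whiskerRight, ← MonoidalLinear.smul_whiskerRight, h₁]
    have assoc_YZW : (F.obj X ◁ ((t.μ Y Z).hom ▷ F.obj W)) ≫ (F.obj X ◁ (t.μ (Y ⊗ Z) W).hom) ≫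
        (F.obj X ◁ F.map (α_ Y Z W).hom) = (c₃ : k) • ((F.obj X ◁ (α_ _ _ _).hom) ≫
          (F.obj X ◁ (F.obj Y ◁ (t.μ Z W).hom)) ≫ (F.obj X ◁ (t.μ Y (Z ⊗ W)).hom)) := by
      simp only [← MonoidalCategory.whiskerLeft_comp, ← MonoidalLinear.whiskerLeft_smul, h₃]
    rw [← reassoc_of% t.naturality_left, reassoc_of% assoc_XYZ, Linear.smul_comp]
    simp only [Category.assoc]
    rw [reassoc_of% h₂]
    simp only [Linear.smul_comp, Linear.comp_smul, Category.assoc]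
    rw [← t.naturality_right, associator_naturality_middle_assoc, reassoc_of% assoc_YZW]
    simp only [Linear.smul_comp, Linear.comp_smul, Category.assoc, smul_smul, Units.val_mul]
    simp [mul_assoc, pentagonIso]
  · rw [← F.map_comp, ← F.map_comp, MonoidalCategory.pentagon, F.map_comp, reassoc_of% h₄]
    simp only [Linear.smul_comp, Linear.comp_smul, Category.assoc]
    rw [associator_naturality_left_assoc, ← whisker_exchange_assoc, h₅]
    simp only [Linear.comp_smul, smul_smul, Units.val_mul]
    congr 1
    simp [pentagonIso]

section Braiding

variable [BraidedCategory C] [BraidedCategory D]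

theorem BraidScalar.of_iso {X X' Y Y' : C} {c : kˣ}
    (h : t.BraidScalar k X Y c) (f : X ≅ X') (g : Y ≅ Y') : t.BraidScalar k X' Y' c := by
  rw [BraidScalar] at h ⊢
  rw [← cancel_epi (F.map f.hom ⊗ₘ F.map g.hom), t.braidLeft_naturality, h, Linear.comp_smul,
    t.braidRight_naturality, Linear.smul_comp]

variable (t) in
/-- The composite of the structure maps of `F` from `(F X ⊗ F Y) ⊗ F Z` to `F (Y ⊗ Z ⊗ X)` which
permutes the factors first. -/
def hexagonForwardIso (X Y Z : C) : (F.obj X ⊗ F.obj Y) ⊗ F.obj Z ≅ F.obj (Y ⊗ Z ⊗ X) :=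
  α_ _ _ _ ≪≫ β_ _ _ ≪≫ α_ _ _ _ ≪≫ whiskerLeftIso _ (t.μ Z X) ≪≫ t.μ Y (Z ⊗ X)

variable (t) in
/-- The composite of the structure maps of `F` from `F X ⊗ F Y ⊗ F Z` to `F ((Z ⊗ X) ⊗ Y)` which
permutes the factors first. -/
def hexagonReverseIso (X Y Z : C) : F.obj X ⊗ F.obj Y ⊗ F.obj Z ≅ F.obj ((Z ⊗ X) ⊗ Y) :=
  (α_ _ _ _).symm ≪≫ β_ _ _ ≪≫ (α_ _ _ _).symm ≪≫ whiskerRightIso (t.μ Z X) _ ≪≫ t.μ (Z ⊗ X) Y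

variable [MonoidalPreadditive D] [MonoidalLinear k D]

theorem hexagon_forward {X Y Z : C} {c₁ c₂ c₃ d₁ d₂ d₃ : kˣ}
    (h₁ : t.AssocScalar k X Y Z c₁) (h₂ : t.AssocScalar k Y Z X c₂)
    (h₃ : t.AssocScalar k Y X Z c₃) (g₁ : t.BraidScalar k X (Y ⊗ Z) d₁)
    (g₂ : t.BraidScalar k X Y d₂) (g₃ : t.BraidScalar k X Z d₃) :
    ((c₁ * d₁ * c₂ : kˣ) : k) • (t.hexagonForwardIso X Y Z).hom =
      ((d₂ * c₃ * d₃ : kˣ) : k) • (t.hexagonForwardIso X Y Z).hom := by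
  rw [AssocScalar, assocLeft_hom, assocRight_hom] at h₁ h₂ h₃
  rw [BraidScalar, braidLeft_hom, braidRight_hom] at g₁ g₂ g₃
  trans ((t.μ X Y).hom ▷ F.obj Z) ≫ (t.μ (X ⊗ Y) Z).hom ≫ F.map (α_ X Y Z).hom ≫
    F.map (β_ X (Y ⊗ Z)).hom ≫ F.map (α_ Y Z X).hom
  · rw [reassoc_of% h₁]
    simp only [Linear.smul_comp, Category.assoc]
    rw [reassoc_of% g₁]
    simp only [Linear.smul_comp, Linear.comp_smul, Category.assoc]
    rw [BraidedCategory.braiding_naturality_right_assoc, h₂]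
    simp only [Linear.comp_smul, smul_smul, Units.val_mul]
    simp [mul_assoc, hexagonForwardIso]
  · have braid_XY : ((t.μ X Y).hom ▷ F.obj Z) ≫ (F.map (β_ X Y).hom ▷ F.obj Z) =
        (d₂ : k) • (((β_ _ _).hom ▷ F.obj Z) ≫ ((t.μ Y X).hom ▷ F.obj Z)) := by
      simp only [← comp_whiskerRight, ← MonoidalLinear.smul_whiskerRight, g₂]
    have braid_XZ : (F.obj Y ◁ (t.μ X Z).hom) ≫ (F.obj Y ◁ F.map (β_ X Z).hom) =
        (d₃ : k) • ((F.obj Y ◁ (β_ _ _).hom) ≫ (F.obj Y ◁ (t.μ Z X).hom)) := by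
      simp only [← MonoidalCategory.whiskerLeft_comp, ← MonoidalLinear.whiskerLeft_smul, g₃]
    rw [← F.map_comp, ← F.map_comp, BraidedCategory.hexagon_forward, F.map_comp, F.map_comp,
      ← reassoc_of% t.naturality_left, reassoc_of% braid_XY]
    simp only [Linear.smul_comp, Category.assoc]
    rw [reassoc_of% h₃]
    simp only [Linear.smul_comp, Linear.comp_smul, Category.assoc]
    rw [← t.naturality_right, reassoc_of% braid_XZ]
    simp only [Linear.smul_comp, Linear.comp_smul, Category.assoc, smul_smul, Units.val_mul]
    simp [mul_assoc, hexagonForwardIso]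

theorem hexagon_reverse {X Y Z : C} {c₁ c₂ c₃ d₁ d₂ d₃ : kˣ}
    (h₁ : t.AssocScalar k X Y Z c₁) (h₂ : t.AssocScalar k Z X Y c₂)
    (h₃ : t.AssocScalar k X Z Y c₃) (g₁ : t.BraidScalar k (X ⊗ Y) Z d₁)
    (g₂ : t.BraidScalar k Y Z d₂) (g₃ : t.BraidScalar k X Z d₃) :
    ((c₁⁻¹ * d₁ * c₂⁻¹ : kˣ) : k) • (t.hexagonReverseIso X Y Z).hom =
      ((d₂ * c₃⁻¹ * d₃ : kˣ) : k) • (t.hexagonReverseIso X Y Z).hom := by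
  replace h₁ := h₁.comp_map_associator_inv
  replace h₂ := h₂.comp_map_associator_inv
  replace h₃ := h₃.comp_map_associator_inv
  rw [BraidScalar, braidLeft_hom, braidRight_hom] at g₁ g₂ g₃
  trans (F.obj X ◁ (t.μ Y Z).hom) ≫ (t.μ X (Y ⊗ Z)).hom ≫ F.map (α_ X Y Z).inv ≫
    F.map (β_ (X ⊗ Y) Z).hom ≫ F.map (α_ Z X Y).inv
  · rw [reassoc_of% h₁]
    simp only [Linear.smul_comp, Category.assoc]
    rw [reassoc_of% g₁]
    simp only [Linear.smul_comp, Linear.comp_smul, Category.assoc]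
    rw [BraidedCategory.braiding_naturality_left_assoc, h₂]
    simp only [Linear.comp_smul, smul_smul, Units.val_mul]
    simp [mul_assoc, hexagonReverseIso]
  · have braid_YZ : (F.obj X ◁ (t.μ Y Z).hom) ≫ (F.obj X ◁ F.map (β_ Y Z).hom) =
        (d₂ : k) • ((F.obj X ◁ (β_ _ _).hom) ≫ (F.obj X ◁ (t.μ Z Y).hom)) := by
      simp only [← MonoidalCategory.whiskerLeft_comp, ← MonoidalLinear.whiskerLeft_smul, g₂]
    have braid_XZ : ((t.μ X Z).hom ▷ F.obj Y) ≫ (F.map (β_ X Z).hom ▷ F.obj Y) =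
        (d₃ : k) • (((β_ _ _).hom ▷ F.obj Y) ≫ ((t.μ Z X).hom ▷ F.obj Y)) := by
      simp only [← comp_whiskerRight, ← MonoidalLinear.smul_whiskerRight, g₃]
    rw [← F.map_comp, ← F.map_comp, BraidedCategory.hexagon_reverse, F.map_comp, F.map_comp,
      ← reassoc_of% t.naturality_right, reassoc_of% braid_YZ]
    simp only [Linear.smul_comp, Category.assoc]
    rw [reassoc_of% h₃]
    simp only [Linear.smul_comp, Linear.comp_smul, Category.assoc]
    rw [← t.naturality_left, reassoc_of% braid_XZ]
    simp only [Linear.smul_comp, Linear.comp_smul, Category.assoc, smul_smul, Units.val_mul]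
    simp [mul_assoc, hexagonReverseIso]

end Braiding

end Linear

end Tensorator

end Tensorator

/-! ### Uniqueness of pointed braided fusion categories -/

section Uniqueness

universe w v u v' u' uA

section Scalars

variable {k : Type w} [Field k] {D : Type u'} [Category.{v'} D] [Preadditive D] [Linear k D]

namespace IsSimpleBasis

variable {I : Type*} {T : I → D}

theorem exists_hom_eq_smul_hom (H : IsSimpleBasis k T) {i : I} {W W' : D} (e : W ≅ T i)
    (f g : W ≅ W') : ∃ c : kˣ, f.hom = (c : k) • g.hom := by
  obtain ⟨c, hc⟩ := H.schur i (e.inv ≫ f.hom ≫ g.inv ≫ e.hom)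
  have hfg : f.hom = c • g.hom := by
    rw [← cancel_epi e.inv, ← cancel_mono (g.inv ≫ e.hom), Category.assoc, hc]
    simp
  have hc0 : c ≠ 0 := by
    rintro rfl
    rw [zero_smul] at hfg
    refine H.id_ne_zero i ?_
    rw [← e.inv_hom_id, ← Category.id_comp e.hom, ← f.hom_inv_id, hfg]
    simp
  exact ⟨Units.mk0 c hc0, hfg⟩

theorem eq_of_smul_hom_eq_smul_hom (H : IsSimpleBasis k T) {i : I} {W W' : D} (e : W ≅ T i)
    (f : W ≅ W') {c c' : kˣ} (h : (c : k) • f.hom = (c' : k) • f.hom) : c = c' := by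
  have h_id : ((c : k) - c') • 𝟙 (T i) = 0 := by
    have : e.inv ≫ f.hom ≫ f.inv ≫ e.hom = 𝟙 (T i) := by simp
    rw [← this, ← Linear.comp_smul, ← Linear.smul_comp, sub_smul, h, sub_self, zero_comp,
      comp_zero]
  exact Units.ext (sub_eq_zero.1 ((smul_eq_zero.1 h_id).resolve_right (H.id_ne_zero i)))

theorem nonempty_unit_iso [MonoidalCategory D] {A : Type*} [AddLeftCancelMonoid A] {S : A → D}
    (H : IsSimpleBasis k S) (hS : ∀ a b, Nonempty (S a ⊗ S b ≅ S (a + b)))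
    (h1 : Simple (𝟙_ D)) : Nonempty (𝟙_ D ≅ S 0) := by
  obtain ⟨z, ⟨e⟩⟩ := H.exists_iso_of_simple (𝟙_ D)
  obtain ⟨m⟩ := hS z z
  have hz : z + z = z := H.eq_of_iso (m.symm ≪≫ (e.symm ⊗ᵢ e.symm) ≪≫ λ_ _ ≪≫ e)
  rw [add_eq_left] at hz
  subst hz
  exact ⟨e⟩

end IsSimpleBasis

/-- The isomorphism `e` multiplied by the invertible scalar `c`. -/
@[simps]
def smulIso {X Y : D} (c : kˣ) (e : X ≅ Y) : X ≅ Y where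
  hom := (c : k) • e.hom
  inv := ((c⁻¹ : kˣ) : k) • e.inv
  hom_inv_id := by rw [Linear.smul_comp, Linear.comp_smul, smul_smul]; simp
  inv_hom_id := by rw [Linear.smul_comp, Linear.comp_smul, smul_smul]; simp

theorem braiding_self_of_iso [MonoidalCategory D] [BraidedCategory D] {X Y : D} (e : X ≅ Y) {c : k}
    (h : (β_ Y Y).hom = c • 𝟙 (Y ⊗ Y)) : (β_ X X).hom = c • 𝟙 (X ⊗ X) := by
  have h_naturality := BraidedCategory.braiding_naturality e.hom e.hom
  rw [h, Linear.comp_smul, Category.comp_id] at h_naturality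
  rw [← cancel_mono (e.hom ⊗ₘ e.hom), ← h_naturality, Linear.smul_comp, Category.id_comp]

end Scalars

section TensorExt

variable {k : Type w} [Field k] {C : Type u} [Category.{v} C] [Preadditive C] [Linear k C]
  {D : Type u'} [Category.{v'} D] [MonoidalCategory D] [Preadditive D] [MonoidalPreadditive D]
  {F : C ⥤ D} [F.Additive] {I : Type*} {S : I → C}

theorem IsSimpleBasis.hom_ext_tensor (H : IsSimpleBasis k S) {X Y : C} {W : D}
    {f g : F.obj X ⊗ F.obj Y ⟶ W}
    (h : ∀ a b (x : S a ⟶ X) (y : S b ⟶ Y),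
      (F.map x ⊗ₘ F.map y) ≫ f = (F.map x ⊗ₘ F.map y) ≫ g) : f = g := by
  refine H.hom_ext_map (F ⋙ tensorRight (F.obj Y)) fun a x => ?_
  refine H.hom_ext_map (F ⋙ tensorLeft (F.obj (S a))) fun b y => ?_
  have := h a b x y
  rw [MonoidalCategory.tensorHom_def'] at this
  simpa using this

theorem IsSimpleBasis.hom_ext_tensor₃ (H : IsSimpleBasis k S) {X Y Z : C} {W : D}
    {f g : (F.obj X ⊗ F.obj Y) ⊗ F.obj Z ⟶ W}
    (h : ∀ a b c (x : S a ⟶ X) (y : S b ⟶ Y) (z : S c ⟶ Z),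
      ((F.map x ⊗ₘ F.map y) ⊗ₘ F.map z) ≫ f = ((F.map x ⊗ₘ F.map y) ⊗ₘ F.map z) ≫ g) :
    f = g := by
  refine H.hom_ext_map (F ⋙ tensorRight (F.obj Y) ⋙ tensorRight (F.obj Z)) fun a x => ?_
  refine H.hom_ext_map (F ⋙ tensorLeft (F.obj (S a)) ⋙ tensorRight (F.obj Z)) fun b y => ?_
  refine H.hom_ext_map (F ⋙ tensorLeft (F.obj (S a) ⊗ F.obj (S b))) fun c z => ?_
  have := h a b c x y z
  rw [MonoidalCategory.tensorHom_def', MonoidalCategory.tensorHom_def', comp_whiskerRight] at this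
  simpa using this

end TensorExt

namespace Tensorator

variable {C : Type u} [Category.{v} C] [MonoidalCategory C]
  {D : Type u'} [Category.{v'} D] [MonoidalCategory D]
  {k : Type w} [Field k] [Preadditive D] [Linear k D] {F : C ⥤ D}

section Basis

variable [Preadditive C] [Linear k C] [MonoidalPreadditive D]
  {I : Type*} {S : I → C} [F.Additive]

theorem assocLeft_eq_assocRight_of_basis (H : IsSimpleBasis k S) (t : Tensorator F)
    (h : ∀ a b c, t.AssocScalar k (S a) (S b) (S c) 1) (X Y Z : C) :
    (t.assocLeft X Y Z).hom = (t.assocRight X Y Z).hom := by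
  refine H.hom_ext_tensor₃ fun a b c x y z => ?_
  have := h a b c
  rw [AssocScalar, Units.val_one, one_smul] at this
  rw [assocLeft_naturality, assocRight_naturality, this]

theorem braidLeft_eq_braidRight_of_basis [BraidedCategory C] [BraidedCategory D]
    (H : IsSimpleBasis k S) (t : Tensorator F) (h : ∀ a b, t.BraidScalar k (S a) (S b) 1)
    (X Y : C) : (t.braidLeft X Y).hom = (t.braidRight X Y).hom := by
  refine H.hom_ext_tensor fun a b x y => ?_
  have := h a b
  rw [BraidScalar, Units.val_one, one_smul] at this
  rw [braidLeft_naturality, braidRight_naturality, this]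

end Basis

theorem μ_eq_smul_of_iso {t t' : Tensorator F} {X X' Y Y' : C} {c : kˣ}
    (h : (t'.μ X Y).hom = (c : k) • (t.μ X Y).hom) (f : X ≅ X') (g : Y ≅ Y') :
    (t'.μ X' Y').hom = (c : k) • (t.μ X' Y').hom := by
  rw [← cancel_epi (F.map f.hom ⊗ₘ F.map g.hom), t'.naturality, h, Linear.comp_smul, t.naturality,
    Linear.smul_comp]

theorem AssocScalar.rescale [MonoidalPreadditive D] [MonoidalLinear k D] {t t' : Tensorator F}
    {X Y Z : C} {c d₁ d₂ d₃ d₄ : kˣ} (h : t.AssocScalar k X Y Z c)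
    (h₁ : (t'.μ Y Z).hom = (d₁ : k) • (t.μ Y Z).hom)
    (h₂ : (t'.μ X (Y ⊗ Z)).hom = (d₂ : k) • (t.μ X (Y ⊗ Z)).hom)
    (h₃ : (t'.μ X Y).hom = (d₃ : k) • (t.μ X Y).hom)
    (h₄ : (t'.μ (X ⊗ Y) Z).hom = (d₄ : k) • (t.μ (X ⊗ Y) Z).hom) :
    t'.AssocScalar k X Y Z (c / (d₁ * d₂ / d₃ / d₄)) := by
  rw [AssocScalar, assocLeft_hom, assocRight_hom] at h ⊢
  rw [h₁, h₂, h₃, h₄]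
  simp only [MonoidalLinear.smul_whiskerRight, MonoidalLinear.whiskerLeft_smul,
    Linear.smul_comp, Linear.comp_smul, h, smul_smul, ← Units.val_mul]
  congr 2
  rw [mul_comm d₂ d₁, div_div, div_div_eq_mul_div, div_mul_cancel, mul_comm c, mul_assoc d₃,
    mul_left_comm]

theorem BraidScalar.rescale [BraidedCategory C] [BraidedCategory D] {t t' : Tensorator F}
    {X Y : C} {c d₁ d₂ : kˣ} (h : t.BraidScalar k X Y c)
    (h₁ : (t'.μ Y X).hom = (d₁ : k) • (t.μ Y X).hom)
    (h₂ : (t'.μ X Y).hom = (d₂ : k) • (t.μ X Y).hom) :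
    t'.BraidScalar k X Y (c / (d₁ / d₂)) := by
  rw [BraidScalar, braidLeft_hom, braidRight_hom] at h ⊢
  rw [h₁, h₂]
  simp only [Linear.smul_comp, Linear.comp_smul, h, smul_smul, ← Units.val_mul]
  congr 2
  rw [div_div_eq_mul_div, div_mul_cancel, mul_comm]

theorem exists_isAbelianCocycle [BraidedCategory C] [BraidedCategory D] [MonoidalPreadditive D]
    [MonoidalLinear k D] {A : Type uA} [AddCommGroup A] {S : A → C} {T : A → D}
    (H : IsSimpleBasis k T) (hS : ∀ a b, Nonempty (S a ⊗ S b ≅ S (a + b)))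
    (hT : ∀ a b, Nonempty (T a ⊗ T b ≅ T (a + b)))
    (hF : ∀ a, Nonempty (F.obj (S a) ≅ T a)) (t : Tensorator F) :
    ∃ (ω : A → A → A → Additive kˣ) (c : A → A → Additive kˣ), IsAbelianCocycle ω c ∧
      (∀ x y z, t.AssocScalar k (S x) (S y) (S z) (ω x y z).toMul) ∧
      ∀ x y, t.BraidScalar k (S x) (S y) (c x y).toMul := by
  let m := fun a b => (hS a b).some
  let m₂ : ∀ a b, F.obj (S a) ⊗ F.obj (S b) ≅ T (a + b) := fun a b =>
    ((hF a).some ⊗ᵢ (hF b).some) ≪≫ (hT a b).some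
  let m₃ : ∀ a b c, (F.obj (S a) ⊗ F.obj (S b)) ⊗ F.obj (S c) ≅ T (a + b + c) := fun a b c =>
    (m₂ a b ⊗ᵢ (hF c).some) ≪≫ (hT _ _).some
  let m₄ : ∀ a b c d, ((F.obj (S a) ⊗ F.obj (S b)) ⊗ F.obj (S c)) ⊗ F.obj (S d) ≅
    T (a + b + c + d) := fun a b c d => (m₃ a b c ⊗ᵢ (hF d).some) ≪≫ (hT _ _).some
  have exists_assocScalar (x y z : A) : ∃ c, t.AssocScalar k (S x) (S y) (S z) c :=
    H.exists_hom_eq_smul_hom (m₃ x y z) _ _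
  have exists_braidScalar (x y : A) : ∃ c, t.BraidScalar k (S x) (S y) c :=
    H.exists_hom_eq_smul_hom (m₂ x y) _ _
  choose ω hω using exists_assocScalar
  choose c hc using exists_braidScalar
  refine ⟨fun x y z => Additive.ofMul (ω x y z), fun x y => Additive.ofMul (c x y),
    ⟨fun x y z w => ?_, fun x y z => ?_, fun x y z => ?_⟩, hω, hc⟩
  · exact congrArg Additive.ofMul (H.eq_of_smul_hom_eq_smul_hom (m₄ x y z w) _ ((hω x y z).pentagon
      ((hω x (y + z) w).of_iso (Iso.refl _) (m y z).symm (Iso.refl _)) (hω y z w)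
      ((hω (x + y) z w).of_iso (m x y).symm (Iso.refl _) (Iso.refl _))
      ((hω x y (z + w)).of_iso (Iso.refl _) (Iso.refl _) (m z w).symm)))
  · exact congrArg Additive.ofMul (H.eq_of_smul_hom_eq_smul_hom (m₃ x y z) _
      (hexagon_forward (hω x y z) (hω y z x) (hω y x z)
        ((hc x (y + z)).of_iso (Iso.refl _) (m y z).symm) (hc x y) (hc x z)))
  · simpa only [sub_eq_add_neg, ofMul_mul, ofMul_inv] using congrArg Additive.ofMul
      (H.eq_of_smul_hom_eq_smul_hom ((α_ _ _ _).symm ≪≫ m₃ x y z) _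
        (hexagon_reverse (hω x y z) (hω z x y) (hω x z y)
          ((hc (x + y) z).of_iso (m x y).symm (Iso.refl _)) (hc y z) (hc x z)))

theorem exists_coherent [BraidedCategory C] [BraidedCategory D] [Preadditive C]
    [MonoidalPreadditive C] [Linear k C] [MonoidalLinear k C] [MonoidalPreadditive D]
    [MonoidalLinear k D] [F.Additive] [F.Linear k] {A : Type uA} [AddCommGroup A] {S : A → C}
    (H : IsSimpleBasis k S) (hS : ∀ a b, Nonempty (S a ⊗ S b ≅ S (a + b))) (t : Tensorator F)
    {ω : A → A → A → Additive kˣ} {c : A → A → Additive kˣ}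
    (hω : ∀ x y z, t.AssocScalar k (S x) (S y) (S z) (ω x y z).toMul)
    (hc : ∀ x y, t.BraidScalar k (S x) (S y) (c x y).toMul) (hb : IsAbelianCoboundary ω c) :
    ∃ t' : Tensorator F, (∀ X Y Z, (t'.assocLeft X Y Z).hom = (t'.assocRight X Y Z).hom) ∧
      ∀ X Y, (t'.braidLeft X Y).hom = (t'.braidRight X Y).hom := by
  obtain ⟨h, hωh, hch⟩ := hb
  obtain ⟨t', ht'⟩ := exists_μ_eq H F fun a b => smulIso (h a b).toMul (t.μ (S a) (S b))
  have ht : ∀ a b {X Y : C} (_ : X ≅ S a) (_ : Y ≅ S b),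
      (t'.μ X Y).hom = ((h a b).toMul : k) • (t.μ X Y).hom := fun a b X Y f g =>
    μ_eq_smul_of_iso (by rw [ht', smulIso_hom]) f.symm g.symm
  refine ⟨t', assocLeft_eq_assocRight_of_basis H t' fun x y z => ?_,
    braidLeft_eq_braidRight_of_basis H t' fun x y => ?_⟩
  · have := (hω x y z).rescale (ht y z (Iso.refl _) (Iso.refl _))
      (ht x (y + z) (Iso.refl _) (hS y z).some) (ht x y (Iso.refl _) (Iso.refl _))
      (ht (x + y) z (hS x y).some (Iso.refl _))
    rwa [hωh, assocCoboundary, toMul_sub, toMul_sub, toMul_add, div_self'] at this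
  · have := (hc x y).rescale (ht y x (Iso.refl _) (Iso.refl _)) (ht x y (Iso.refl _) (Iso.refl _))
    rwa [hch, braidCoboundary, toMul_sub, div_self'] at this

theorem braidScalar_self [BraidedCategory C] [BraidedCategory D] [Preadditive C] [Linear k C]
    [F.Linear k] (t : Tensorator F) {X : C} {c : k} (hX : (β_ X X).hom = c • 𝟙 (X ⊗ X))
    (hFX : (β_ (F.obj X) (F.obj X)).hom = c • 𝟙 (F.obj X ⊗ F.obj X)) :
    t.BraidScalar k X X 1 := by
  rw [BraidScalar, braidLeft_hom, braidRight_hom, hX, hFX, F.map_smul, F.map_id,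
    Linear.comp_smul, Linear.smul_comp, Category.comp_id, Category.id_comp, Units.val_one,
    one_smul]

theorem exists_unit_iso [MonoidalPreadditive D] [MonoidalLinear k D] (t : Tensorator F)
    {I : Type*} {T : I → D} (H : IsSimpleBasis k T) {i : I} (u : 𝟙_ D ≅ T i)
    (v : F.obj (𝟙_ C) ≅ T i) : ∃ e : 𝟙_ D ≅ F.obj (𝟙_ C),
      (e.hom ▷ F.obj (𝟙_ C)) ≫ (t.μ (𝟙_ C) (𝟙_ C)).hom ≫ F.map (λ_ (𝟙_ C)).hom =
        (λ_ (F.obj (𝟙_ C))).hom := by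
  let e := u ≪≫ v.symm
  obtain ⟨r, hr⟩ := H.exists_hom_eq_smul_hom (λ_ _ ≪≫ v) (λ_ (F.obj (𝟙_ C)))
    (whiskerRightIso e (F.obj (𝟙_ C)) ≪≫ t.μ _ _ ≪≫ F.mapIso (λ_ (𝟙_ C)))
  refine ⟨smulIso r e, ?_⟩
  rw [hr, smulIso_hom, MonoidalLinear.smul_whiskerRight, Linear.smul_comp]
  rfl

end Tensorator

theorem IsPointedBraidedFusion.braidedEquivalent {C : Type u} [Category.{v} C] [MonoidalCategory C]
    [BraidedCategory C] [Preadditive C] [MonoidalPreadditive C] {D : Type u'} [Category.{v'} D]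
    [MonoidalCategory D] [BraidedCategory D] [Preadditive D] [MonoidalPreadditive D]
    {k : Type w} [Field k] [IsAlgClosed k] [Linear k C] [MonoidalLinear k C] [Linear k D]
    [MonoidalLinear k D] {A : Type uA} [AddCommGroup A] [Finite A] {q : A → kˣ}
    (hC : IsPointedBraidedFusion k C A q) (hD : IsPointedBraidedFusion k D A q) :
    BraidedEquivalent k C D := by
  obtain ⟨S, hS₁, hS₂, hS₃, hS, hSq⟩ := hC.hasInvariant
  obtain ⟨T, hT₁, hT₂, hT₃, hT, hTq⟩ := hD.hasInvariant
  have H := hC.isFusion.isSimpleBasis S hS₁ hS₂ hS₃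
  have H' := hD.isFusion.isSimpleBasis T hT₁ hT₂ hT₃
  have := hC.isFusion.isAbelian.hasFiniteProducts
  have := hD.isFusion.isAbelian.hasFiniteProducts
  have : HasFiniteBiproducts C := HasFiniteBiproducts.of_hasFiniteProducts
  have : HasFiniteBiproducts D := HasFiniteBiproducts.of_hasFiniteProducts
  obtain ⟨F, hF, _, _, hFS⟩ := H.exists_equivalence H'
  have m (a b) : F.obj (S a) ⊗ F.obj (S b) ≅ F.obj (S a ⊗ S b) :=
    ((hFS a).some ⊗ᵢ (hFS b).some) ≪≫ (hT a b).some ≪≫ (hFS (a + b)).some.symm ≪≫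
      F.mapIso (hS a b).some.symm
  obtain ⟨t, -⟩ := Tensorator.exists_μ_eq H F m
  obtain ⟨ω, c, hωc, hω, hc⟩ := t.exists_isAbelianCocycle H' hS hT hFS
  have c_self (x : A) : c x x = 0 := by
    have h_one := t.braidScalar_self (hSq x) (braiding_self_of_iso (hFS x).some (hTq x))
    exact congrArg Additive.ofMul (H'.eq_of_smul_hom_eq_smul_hom
      (((hFS x).some ⊗ᵢ (hFS x).some) ≪≫ (hT x x).some) _ ((hc x x).symm.trans h_one))
  obtain ⟨t', hα, hβ⟩ := t.exists_coherent H hS hω hc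
    (hωc.isAbelianCoboundary (baer_additive_units k) c_self)
  obtain ⟨u⟩ := H.nonempty_unit_iso hS hC.isFusion.simple_unit
  obtain ⟨u'⟩ := H'.nonempty_unit_iso hT hD.isFusion.simple_unit
  obtain ⟨e, he⟩ := t'.exists_unit_iso H' u' (F.mapIso u ≪≫ (hFS 0).some)
  exact ⟨F, t'.nonempty_braided e he hα hβ, hF, inferInstance, inferInstance⟩

end Uniqueness

/-! ### Isotypic decompositions -/

section Characters

universe w uA

variable {k : Type w} [Field k]

theorem sum_addMonoidHom_units_eq_zero {G : Type*} [AddGroup G] [Fintype G] {χ : G →+ Additive kˣ}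
    (h : χ ≠ 0) : ∑ g, ((χ g).toMul : k) = 0 := by
  refine (Fintype.sum_equiv Multiplicative.ofAdd _ _ fun _ => rfl).trans (sum_hom_units_eq_zero
    ((Units.coeHom k).comp (AddMonoidHom.toMultiplicativeLeft χ))
    fun h' => h (AddMonoidHom.ext fun g => ?_))
  exact congrArg Additive.ofMul (Units.ext (DFunLike.congr_fun h' (Multiplicative.ofAdd g)))

variable {A : Type uA} [AddCommGroup A] [Finite A]

instance : Finite (CharGroup k A) :=
  Finite.of_equiv _ (AddMonoidHom.toMultiplicativeLeft (α := A) (β := kˣ)).symm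

variable [IsAlgClosed k] [NeZero (Nat.card A : k)]

variable (k A) in
theorem hasEnoughRootsOfUnity_exponent :
    HasEnoughRootsOfUnity k (Monoid.exponent (Multiplicative A)) :=
  have : NeZero (Monoid.exponent (Multiplicative A)) := ⟨Monoid.exponent_ne_zero_of_finite⟩
  have : NeZero (Monoid.exponent (Multiplicative A) : k) := ⟨ne_zero_of_dvd_ne_zero
    (NeZero.ne (Nat.card A : k)) (Nat.cast_dvd_cast Group.exponent_dvd_nat_card)⟩
  inferInstance

variable (k A) in
theorem card_charGroup : Nat.card (CharGroup k A) = Nat.card A := by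
  have := hasEnoughRootsOfUnity_exponent k A
  exact (Nat.card_congr AddMonoidHom.toMultiplicativeLeft).trans
    (CommGroup.card_monoidHom_of_hasEnoughRootsOfUnity (Multiplicative A) k)

theorem exists_char_ne_zero {a : A} (h : a ≠ 0) : ∃ χ : CharGroup k A, χ a ≠ 0 := by
  have := hasEnoughRootsOfUnity_exponent k A
  obtain ⟨ψ, hψ⟩ := CommGroup.exists_apply_ne_one_of_hasEnoughRootsOfUnity (Multiplicative A) k
    (ofAdd_eq_one.not.2 h)
  exact ⟨MonoidHom.toAdditiveRight ψ, fun h' => hψ (Additive.ofMul.injective h')⟩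

theorem sum_charGroup_eq_zero [Fintype (CharGroup k A)] {a : A} (h : a ≠ 0) :
    ∑ χ : CharGroup k A, ((χ a).toMul : k) = 0 := by
  obtain ⟨χ, hχ⟩ := exists_char_ne_zero (k := k) h
  exact sum_addMonoidHom_units_eq_zero (χ := AddMonoidHom.eval a)
    fun h' => hχ (DFunLike.congr_fun h' χ)

end Characters

section IsotypicIdempotent

variable {k : Type*} [Field k] {A : Type*} [AddCommGroup A] [Fintype A] {R : Type*} [Ring R]
  [Algebra k R]

/-- The idempotent projecting a representation `ρ` of `A` onto the part on which `A` acts by the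
character `φ`. -/
def isotypicIdempotent (ρ : Multiplicative A →* R) (φ : CharGroup k A) : R :=
  (Fintype.card A : k)⁻¹ • ∑ a, ((φ (-a)).toMul : k) • ρ (Multiplicative.ofAdd a)

theorem isotypicIdempotent_mul (ρ : Multiplicative A →* R) (φ : CharGroup k A) (a : A) :
    isotypicIdempotent ρ φ * ρ (Multiplicative.ofAdd a) =
      ((φ a).toMul : k) • isotypicIdempotent ρ φ := by
  rw [isotypicIdempotent, smul_mul_assoc, Finset.sum_mul, smul_comm,
    Finset.smul_sum (r := ((φ a).toMul : k))]
  congr 1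
  refine Fintype.sum_equiv (Equiv.addRight a) _ _ fun b => ?_
  simp [smul_smul]

theorem mul_isotypicIdempotent (ρ : Multiplicative A →* R) (φ : CharGroup k A) (a : A) :
    ρ (Multiplicative.ofAdd a) * isotypicIdempotent ρ φ =
      ((φ a).toMul : k) • isotypicIdempotent ρ φ := by
  have (b : A) : ρ (Multiplicative.ofAdd a) * ρ (Multiplicative.ofAdd b) =
      ρ (Multiplicative.ofAdd b) * ρ (Multiplicative.ofAdd a) := by
    rw [← map_mul, mul_comm, map_mul]
  rw [← isotypicIdempotent_mul]
  simp only [isotypicIdempotent, mul_smul_comm, smul_mul_assoc, Finset.mul_sum, Finset.sum_mul,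
    this]

theorem isotypicIdempotent_mul_isotypicIdempotent (ρ : Multiplicative A →* R)
    (φ ψ : CharGroup k A) : isotypicIdempotent ρ φ * isotypicIdempotent ρ ψ =
      ((Fintype.card A : k)⁻¹ * ∑ a, (((φ - ψ) a).toMul : k)) • isotypicIdempotent ρ φ := by
  conv_lhs => rw [isotypicIdempotent.eq_def ρ ψ]
  rw [mul_smul_comm, Finset.mul_sum, mul_smul, Finset.sum_smul]
  congr 1
  refine Finset.sum_congr rfl fun a _ => ?_
  rw [mul_smul_comm, isotypicIdempotent_mul, smul_smul]
  simp [div_eq_mul_inv, mul_comm]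

theorem completeOrthogonalIdempotents_isotypicIdempotent [IsAlgClosed k]
    [NeZero (Nat.card A : k)] [Fintype (CharGroup k A)] (ρ : Multiplicative A →* R) :
    CompleteOrthogonalIdempotents fun φ : CharGroup k A => isotypicIdempotent ρ φ := by
  refine CompleteOrthogonalIdempotents.iff_ortho_complete.2 ⟨fun φ ψ h => ?_, ?_⟩
  · dsimp only
    rw [isotypicIdempotent_mul_isotypicIdempotent,
      sum_addMonoidHom_units_eq_zero (sub_ne_zero.2 h), mul_zero, zero_smul]
  have card_ne_zero : (Fintype.card A : k) ≠ 0 :=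
    Nat.card_eq_fintype_card (α := A) ▸ NeZero.ne (Nat.card A : k)
  have card_eq : Fintype.card (CharGroup k A) = Fintype.card A := by
    simpa only [Nat.card_eq_fintype_card] using card_charGroup k A
  simp only [isotypicIdempotent]
  rw [← Finset.smul_sum, Finset.sum_comm]
  simp only [← Finset.sum_smul]
  rw [Finset.sum_eq_single 0]
  · simp [card_eq, smul_smul, card_ne_zero]
  · intro a _ ha
    rw [sum_charGroup_eq_zero (neg_ne_zero.2 ha), zero_smul]
  · simp

end IsotypicIdempotent

section IdempotentSplitting

universe v u

variable {C : Type u} [Category.{v} C] [Preadditive C] [IsIdempotentComplete C] {X : C}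

theorem exists_decomposition_of_completeOrthogonalIdempotents {J : Type*} [Fintype J]
    {e : J → End X} (he : CompleteOrthogonalIdempotents e) :
    ∃ (Y : J → C) (d : Decomposition Y X), ∀ j, d.π j ≫ d.ι j = e j := by
  choose Y ι π h_ιπ h_πι using fun j =>
    IsIdempotentComplete.idempotents_split X (e j) (he.idem j)
  refine ⟨Y, ⟨ι, π, h_ιπ, fun i j hij => ?_, (Finset.sum_congr rfl fun j _ => h_πι j).trans
    he.complete⟩, h_πι⟩
  have h_ortho : (π i ≫ ι i) ≫ π j ≫ ι j = 0 := by
    rw [h_πι, h_πι]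
    exact he.ortho hij.symm
  calc ι i ≫ π j = ι i ≫ ((π i ≫ ι i) ≫ π j ≫ ι j) ≫ π j := by
        simp only [Category.assoc, h_ιπ, reassoc_of% (h_ιπ i), Category.comp_id]
    _ = 0 := by rw [h_ortho, zero_comp, comp_zero]

theorem exists_isotypic_decomposition {k : Type*} [Field k] [IsAlgClosed k] [Linear k C]
    {A : Type*} [AddCommGroup A] [Finite A] [NeZero (Nat.card A : k)] [Fintype (CharGroup k A)]
    (ρ : Multiplicative A →* End X) :
    ∃ (Y : CharGroup k A → C) (d : Decomposition Y X), ∀ φ a,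
      d.ι φ ≫ ρ (Multiplicative.ofAdd a) = ((φ a).toMul : k) • d.ι φ ∧
      ρ (Multiplicative.ofAdd a) ≫ d.π φ = ((φ a).toMul : k) • d.π φ := by
  have := Fintype.ofFinite A
  obtain ⟨Y, d, hd⟩ := exists_decomposition_of_completeOrthogonalIdempotents
    (completeOrthogonalIdempotents_isotypicIdempotent (k := k) ρ)
  refine ⟨Y, d, fun φ a => ⟨?_, ?_⟩⟩
  · calc d.ι φ ≫ ρ (Multiplicative.ofAdd a)
      _ = d.ι φ ≫ (ρ (Multiplicative.ofAdd a) * isotypicIdempotent ρ φ) := by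
        rw [End.mul_def, ← hd, Category.assoc, reassoc_of% (d.ι_π φ)]
      _ = ((φ a).toMul : k) • d.ι φ := by
        rw [mul_isotypicIdempotent, Linear.comp_smul, ← hd, reassoc_of% (d.ι_π φ)]
  · calc ρ (Multiplicative.ofAdd a) ≫ d.π φ
      _ = (isotypicIdempotent ρ φ * ρ (Multiplicative.ofAdd a)) ≫ d.π φ := by
        rw [End.mul_def, ← hd]
        simp only [Category.assoc, d.ι_π, Category.comp_id]
      _ = ((φ a).toMul : k) • d.π φ := by
        rw [isotypicIdempotent_mul, Linear.smul_comp, ← hd, Category.assoc, d.ι_π,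
          Category.comp_id]

end IdempotentSplitting

/-! ### Lifts to the center -/

section CenterLift

universe v u

variable {C : Type u} [Category.{v} C] [MonoidalCategory C]

variable (C) in
/-- A monoidal automorphism of the identity functor of `C`. As it is invertible, its compatibility
with the unit object follows from that with tensor products. -/
structure TensorAut where
  /-- The component at an object. -/
  app (U : C) : U ≅ U
  naturality {U V : C} (f : U ⟶ V) : f ≫ (app V).hom = (app U).hom ≫ f
  app_tensor_hom (U V : C) : (app (U ⊗ V)).hom = (app U).hom ⊗ₘ (app V).hom

namespace TensorAut

theorem ext {τ σ : TensorAut C} (h : ∀ U, (τ.app U).hom = (σ.app U).hom) : τ = σ := by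
  obtain ⟨τ, _, _⟩ := τ
  obtain ⟨σ, _, _⟩ := σ
  obtain rfl : τ = σ := funext fun U => Iso.ext (h U)
  rfl

instance : Mul (TensorAut C) where
  mul τ σ :=
    { app U := σ.app U ≪≫ τ.app U
      naturality f := by
        rw [Iso.trans_hom, Iso.trans_hom, ← Category.assoc, σ.naturality, Category.assoc,
          τ.naturality, Category.assoc]
      app_tensor_hom U V := by
        simp only [Iso.trans_hom, app_tensor_hom, tensorHom_comp_tensorHom] }

instance : One (TensorAut C) where
  one :=
    { app U := Iso.refl U
      naturality f := (Category.comp_id f).trans (Category.id_comp f).symm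
      app_tensor_hom U V := (id_tensorHom_id U V).symm }

instance : Inv (TensorAut C) where
  inv τ :=
    { app U := (τ.app U).symm
      naturality f := by
        rw [Iso.symm_hom, Iso.symm_hom, Iso.comp_inv_eq, Category.assoc, τ.naturality,
          Iso.inv_hom_id_assoc]
      app_tensor_hom U V := by
        refine (τ.app (U ⊗ V)).inv_ext ?_
        rw [τ.app_tensor_hom, tensorHom_comp_tensorHom, Iso.symm_hom, Iso.symm_hom,
          Iso.hom_inv_id, Iso.hom_inv_id, id_tensorHom_id] }

theorem mul_app_hom (τ σ : TensorAut C) (U : C) :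
    ((τ * σ).app U).hom = (σ.app U).hom ≫ (τ.app U).hom := rfl

theorem one_app_hom (U : C) : ((1 : TensorAut C).app U).hom = 𝟙 U := rfl

instance : Group (TensorAut C) :=
  .ofLeftAxioms (fun _ _ _ => ext fun _ => (Category.assoc _ _ _).symm)
    (fun _ => ext fun _ => Category.comp_id _) fun τ => ext fun U => (τ.app U).hom_inv_id

end TensorAut

variable [BraidedCategory C]

/-- The braiding of `X` with the other objects, followed by the automorphism `τ` of these. -/
def twistedHalfBraiding (τ : TensorAut C) (X : C) : HalfBraiding X where
  β U := β_ X U ≪≫ whiskerRightIso (τ.app U) X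
  monoidal U V := by
    simp only [Iso.trans_hom, whiskerRightIso_hom, τ.app_tensor_hom,
      BraidedCategory.braiding_tensor_right_hom, comp_whiskerRight, Category.assoc,
      MonoidalCategory.whiskerLeft_comp]
    rw [MonoidalCategory.tensorHom_def, comp_whiskerRight,
      ← associator_inv_naturality_left_assoc, whisker_exchange_assoc,
      ← associator_naturality_left_assoc, ← associator_inv_naturality_middle]
  naturality {U V} f := by
    simp only [Iso.trans_hom, whiskerRightIso_hom, Category.assoc]
    rw [BraidedCategory.braiding_naturality_right_assoc, ← comp_whiskerRight,
      ← comp_whiskerRight, τ.naturality]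

theorem twistedHalfBraiding_β_hom (τ : TensorAut C) (X U : C) :
    ((twistedHalfBraiding τ X).β U).hom = (β_ X U).hom ≫ ((τ.app U).hom ▷ X) := rfl

theorem twistedHalfBraiding_naturality_left (τ : TensorAut C) {X Y : C} (f : X ⟶ Y) (U : C) :
    (f ▷ U) ≫ ((twistedHalfBraiding τ Y).β U).hom =
      ((twistedHalfBraiding τ X).β U).hom ≫ (U ◁ f) := by
  rw [twistedHalfBraiding_β_hom, twistedHalfBraiding_β_hom,
    BraidedCategory.braiding_naturality_left_assoc, Category.assoc, whisker_exchange]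

theorem twistedHalfBraiding_one_unit (U : C) :
    ((twistedHalfBraiding (1 : TensorAut C) (𝟙_ C)).β U).hom = (λ_ U).hom ≫ (ρ_ U).inv := by
  rw [twistedHalfBraiding_β_hom, TensorAut.one_app_hom, id_whiskerRight, Category.comp_id,
    braiding_tensorUnit_left]

theorem twistedHalfBraiding_tensor (τ σ : TensorAut C) (X Y U : C) :
    (α_ X Y U).hom ≫ (X ◁ ((twistedHalfBraiding σ Y).β U).hom) ≫ (α_ X U Y).inv ≫
      (((twistedHalfBraiding τ X).β U).hom ▷ Y) ≫ (α_ U X Y).hom =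
      ((twistedHalfBraiding (τ * σ) (X ⊗ Y)).β U).hom := by
  rw [twistedHalfBraiding_β_hom, twistedHalfBraiding_β_hom, twistedHalfBraiding_β_hom,
    TensorAut.mul_app_hom, BraidedCategory.braiding_tensor_left_hom]
  simp only [comp_whiskerRight, MonoidalCategory.whiskerLeft_comp, Category.assoc]
  simp only [associator_inv_naturality_middle_assoc, associator_naturality_left,
    ← comp_whiskerRight_assoc, BraidedCategory.braiding_naturality_right]
  simp only [comp_whiskerRight, Category.assoc, associator_naturality_left_assoc]

/-- The lift of an object of a braided category to the center given by the braiding twisted by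
`τ`. -/
abbrev centerLift (τ : TensorAut C) (X : C) : Center C :=
  ⟨X, twistedHalfBraiding τ X⟩

/-- The section of the forgetful functor from the center that twists the braiding by `τ`. -/
def centerLiftFunctor (τ : TensorAut C) : C ⥤ Center C where
  obj X := centerLift τ X
  map f := ⟨f, twistedHalfBraiding_naturality_left τ f⟩

theorem nonempty_centerLift_tensor_iso (τ σ : TensorAut C) {X Y W : C} (e : X ⊗ Y ≅ W) :
    Nonempty (centerLift τ X ⊗ centerLift σ Y ≅ centerLift (τ * σ) W) := by
  let f : centerLift τ X ⊗ centerLift σ Y ⟶ centerLift (τ * σ) W :=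
    ⟨e.hom, fun U => by
      have h := twistedHalfBraiding_naturality_left (τ * σ) e.hom U
      rw [← twistedHalfBraiding_tensor τ σ X Y U] at h
      exact h⟩
  have : IsIso f.f := inferInstanceAs (IsIso e.hom)
  exact ⟨asIso f⟩

theorem nonempty_unit_centerLift_iso {W : C} (e : 𝟙_ C ≅ W) :
    Nonempty (𝟙_ (Center C) ≅ centerLift (1 : TensorAut C) W) := by
  let f : 𝟙_ (Center C) ⟶ centerLift (1 : TensorAut C) W :=
    ⟨e.hom, fun U => by
      have h := twistedHalfBraiding_naturality_left 1 e.hom U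
      rw [twistedHalfBraiding_one_unit] at h
      exact h⟩
  have : IsIso f.f := inferInstanceAs (IsIso e.hom)
  exact ⟨asIso f⟩

/-- Dual objects of `C` lift to dual objects of the center. -/
@[reducible]
def centerLiftExactPairing (τ : TensorAut C) (X Y : C) [ExactPairing X Y] :
    ExactPairing (centerLift τ X) (centerLift τ⁻¹ Y) where
  coevaluation' := ⟨(η_ X Y : 𝟙_ C ⟶ X ⊗ Y), fun U => by
    have h := twistedHalfBraiding_naturality_left 1 (η_ X Y : 𝟙_ C ⟶ X ⊗ Y) U
    rw [twistedHalfBraiding_one_unit, ← mul_inv_cancel τ, ← twistedHalfBraiding_tensor τ] at h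
    exact h⟩
  evaluation' := ⟨(ε_ X Y : Y ⊗ X ⟶ 𝟙_ C), fun U => by
    have h := twistedHalfBraiding_naturality_left 1 (ε_ X Y : Y ⊗ X ⟶ 𝟙_ C) U
    rw [twistedHalfBraiding_one_unit, ← inv_mul_cancel τ, ← twistedHalfBraiding_tensor τ⁻¹] at h
    exact h⟩
  coevaluation_evaluation' := by
    ext
    simp only [Center.comp_f, Center.whiskerLeft_f, Center.whiskerRight_f,
      Center.associator_inv_f, Center.rightUnitor_hom_f, Center.leftUnitor_inv_f]
    exact ExactPairing.coevaluation_evaluation X Y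
  evaluation_coevaluation' := by
    ext
    simp only [Center.comp_f, Center.whiskerLeft_f, Center.whiskerRight_f,
      Center.associator_hom_f, Center.leftUnitor_hom_f, Center.rightUnitor_inv_f]
    exact ExactPairing.evaluation_coevaluation X Y

variable [Preadditive C]

instance (τ : TensorAut C) [MonoidalPreadditive C] : (centerLiftFunctor τ).Additive where
  map_add := rfl

theorem whiskerRight_f_eq_zero_of_ne {k : Type*} [Field k] [Linear k C] [MonoidalPreadditive C]
    [MonoidalLinear k C] {τ σ : TensorAut C} {X Y U : C} {s t : k}
    (f : centerLift τ X ⟶ centerLift σ Y) (hτ : (τ.app U).hom = t • 𝟙 U)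
    (hσ : (σ.app U).hom = s • 𝟙 U) (hst : t ≠ s) : f.f ▷ U = 0 := by
  obtain ⟨f, h_comm⟩ := f
  change X ⟶ Y at f
  have h_comm : (f ▷ U) ≫ (β_ Y U).hom ≫ ((σ.app U).hom ▷ Y) =
    ((β_ X U).hom ≫ ((τ.app U).hom ▷ X)) ≫ (U ◁ f) := h_comm U
  rw [hτ, hσ, MonoidalLinear.smul_whiskerRight, MonoidalLinear.smul_whiskerRight, id_whiskerRight,
    id_whiskerRight, Linear.comp_smul, Linear.comp_smul, Category.comp_id, Linear.comp_smul,
    Category.comp_id, Linear.smul_comp, ← BraidedCategory.braiding_naturality_left] at h_comm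
  have h_smul : (s - t) • ((f ▷ U) ≫ (β_ Y U).hom) = 0 := by
    rw [sub_smul, h_comm, sub_self]
  exact zero_of_comp_mono _ ((smul_eq_zero.1 h_smul).resolve_left (sub_ne_zero.2 hst.symm))

end CenterLift

section Deviation

universe v u

variable {C : Type u} [Category.{v} C] [MonoidalCategory C]

namespace IsInvertibleObject

variable {U : C}

theorem isEquivalence_tensorRight (hU : IsInvertibleObject U) : (tensorRight U).IsEquivalence := by
  obtain ⟨V, ⟨e⟩, ⟨e'⟩⟩ := hU
  exact .mk' (tensorRight V)
    ((rightUnitorNatIso C).symm ≪≫ (curriedTensor C).flip.mapIso e.symm ≪≫ tensorRightTensor U V)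
    ((tensorRightTensor V U).symm ≪≫ (curriedTensor C).flip.mapIso e' ≪≫ rightUnitorNatIso C)

theorem of_iso {V : C} (hU : IsInvertibleObject U) (e : V ≅ U) : IsInvertibleObject V :=
  let ⟨W, ⟨i⟩, ⟨j⟩⟩ := hU
  ⟨W, ⟨whiskerRightIso e W ≪≫ i⟩, ⟨whiskerLeftIso W e ≪≫ j⟩⟩

end IsInvertibleObject

theorem isInvertibleObject_of_tensor_iso {A : Type*} [AddGroup A] {S : A → C}
    (hS : ∀ a b, Nonempty (S a ⊗ S b ≅ S (a + b))) (h0 : Nonempty (𝟙_ C ≅ S 0)) (a : A) :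
    IsInvertibleObject (S a) :=
  ⟨S (-a), ⟨(hS a (-a)).some ≪≫ eqToIso (by rw [add_neg_cancel]) ≪≫ h0.some.symm⟩,
    ⟨(hS (-a) a).some ≪≫ eqToIso (by rw [neg_add_cancel]) ≪≫ h0.some.symm⟩⟩

variable [BraidedCategory C] {X U V : C} {b : HalfBraiding X} {f g : X ⟶ X}

/-- The half-braiding `b` with `U` differs from the braiding by the endomorphism `f` of `X`. -/
def IsDeviation (b : HalfBraiding X) (U : C) (f : X ⟶ X) : Prop :=
  (b.β U).hom = (f ▷ U) ≫ (β_ X U).hom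

theorem isDeviation_iff : IsDeviation b U f ↔ f ▷ U = (b.β U).hom ≫ (β_ X U).inv := by
  rw [IsDeviation, eq_comm, Iso.eq_comp_inv]

theorem exists_isDeviation (b : HalfBraiding X) (hU : IsInvertibleObject U) :
    ∃ f, IsDeviation b U f := by
  have := hU.isEquivalence_tensorRight
  obtain ⟨f, hf⟩ := (tensorRight U).map_surjective ((b.β U).hom ≫ (β_ X U).inv)
  exact ⟨f, isDeviation_iff.2 hf⟩

namespace IsDeviation

theorem unique (hU : IsInvertibleObject U) (hf : IsDeviation b U f) (hg : IsDeviation b U g) :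
    f = g :=
  have := hU.isEquivalence_tensorRight
  (tensorRight U).map_injective ((isDeviation_iff.1 hf).trans (isDeviation_iff.1 hg).symm)

theorem isIso (hU : IsInvertibleObject U) (hf : IsDeviation b U f) : IsIso f := by
  have := hU.isEquivalence_tensorRight
  have : IsIso ((tensorRight U).map f) := by
    rw [show (tensorRight U).map f = _ from isDeviation_iff.1 hf]
    infer_instance
  exact isIso_of_reflects_iso f (tensorRight U)

theorem of_iso (e : U ≅ V) (hf : IsDeviation b V f) : IsDeviation b U f := by
  rw [IsDeviation, ← cancel_mono (e.hom ▷ X), ← b.naturality, hf, whisker_exchange_assoc,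
    Category.assoc, BraidedCategory.braiding_naturality_right]

theorem tensor (hf : IsDeviation b U f) (hg : IsDeviation b V g) :
    IsDeviation b (U ⊗ V) (f ≫ g) := by
  rw [IsDeviation, b.monoidal, hf, hg, BraidedCategory.braiding_tensor_right_hom]
  simp only [comp_whiskerRight, MonoidalCategory.whiskerLeft_comp, Category.assoc,
    whiskerRight_tensor, Iso.hom_inv_id_assoc]
  rw [← associator_naturality_middle_assoc, ← comp_whiskerRight_assoc (β_ X U).hom,
    ← BraidedCategory.braiding_naturality_left, comp_whiskerRight_assoc]

end IsDeviation

theorem exists_monoidHom_isDeviation {A : Type*} [AddCommGroup A] {S : A → C}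
    (hS : ∀ a b, Nonempty (S a ⊗ S b ≅ S (a + b))) (h0 : Nonempty (𝟙_ C ≅ S 0))
    (b : HalfBraiding X) :
    ∃ ρ : Multiplicative A →* End X, ∀ a, IsDeviation b (S a) (ρ (Multiplicative.ofAdd a)) := by
  have h_inv := isInvertibleObject_of_tensor_iso hS h0
  choose ρ hρ using fun a => exists_isDeviation b (h_inv a)
  have ρ_add (a a' : A) : ρ (a + a') = ρ a ≫ ρ a' :=
    (hρ (a + a')).unique (h_inv _) (((hρ a).tensor (hρ a')).of_iso (hS a a').some.symm)
  have ρ_zero : ρ 0 = 𝟙 X := by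
    have := (hρ 0).isIso (h_inv 0)
    rw [← cancel_epi (ρ 0), ← ρ_add, add_zero, Category.comp_id]
  exact ⟨⟨⟨fun a => ρ a.toAdd, ρ_zero⟩, fun a a' => by
    rw [mul_comm a a']
    exact ρ_add a'.toAdd a.toAdd⟩, hρ⟩

end Deviation

/-! ### The automorphisms of the identity functor defined by characters -/

section CharAut

universe w v u uA

variable {C : Type u} [Category.{v} C] [MonoidalCategory C] [Preadditive C]
  {k : Type w} [Field k] [Linear k C]

theorem IsSimpleBasis.tensorAut_ext {I : Type*} {S : I → C} (H : IsSimpleBasis k S)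
    {τ σ : TensorAut C}
    (h : ∀ a, (τ.app (S a)).hom = (σ.app (S a)).hom) : τ = σ :=
  TensorAut.ext fun _ => H.hom_ext fun a x => by rw [τ.naturality, σ.naturality, h]

variable [MonoidalPreadditive C] [MonoidalLinear k C] {A : Type uA} [AddCommGroup A] {S : A → C}

namespace IsSimpleBasis

theorem exists_tensorAut (H : IsSimpleBasis k S) (hS : ∀ a b, Nonempty (S a ⊗ S b ≅ S (a + b)))
    (φ : CharGroup k A) :
    ∃ τ : TensorAut C, ∀ a, (τ.app (S a)).hom = ((φ a).toMul : k) • 𝟙 (S a) := by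
  obtain ⟨τ, hτ⟩ := H.exists_natIso (𝟭 C) (𝟭 C) fun a => smulIso (φ a).toMul (Iso.refl (S a))
  have naturality {U V : C} (f : U ⟶ V) : f ≫ τ.hom.app V = τ.hom.app U ≫ f :=
    τ.hom.naturality f
  have app_of_iso {U : C} {a : A} (e : U ≅ S a) :
      τ.hom.app U = ((φ a).toMul : k) • 𝟙 U := by
    rw [← cancel_mono e.hom, ← naturality, hτ]
    simp
  refine ⟨⟨fun U => τ.app U, naturality, fun U V => ?_⟩, hτ⟩
  refine H.hom_ext_tensor (F := 𝟭 C) fun a b x y => ?_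
  change (x ⊗ₘ y) ≫ τ.hom.app (U ⊗ V) = (x ⊗ₘ y) ≫ (τ.hom.app U ⊗ₘ τ.hom.app V)
  rw [naturality, tensorHom_comp_tensorHom, naturality, naturality, ← tensorHom_comp_tensorHom,
    hτ, hτ, app_of_iso (hS a b).some, map_add]
  simp [MonoidalCategory.tensorHom_def, smul_smul, mul_comm]

/-- The monoidal automorphism of the identity functor acting on `S a` by `φ a`, as a homomorphism
in the character `φ`. -/
def charAut (H : IsSimpleBasis k S) (hS : ∀ a b, Nonempty (S a ⊗ S b ≅ S (a + b))) :
    Multiplicative (CharGroup k A) →* TensorAut C :=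
  .mk' (fun φ => (H.exists_tensorAut hS φ.toAdd).choose) fun φ ψ => H.tensorAut_ext fun a => by
    rw [TensorAut.mul_app_hom, (H.exists_tensorAut hS _).choose_spec,
      (H.exists_tensorAut hS _).choose_spec, (H.exists_tensorAut hS _).choose_spec]
    simp [smul_smul]

theorem charAut_app_hom (H : IsSimpleBasis k S) (hS : ∀ a b, Nonempty (S a ⊗ S b ≅ S (a + b)))
    (φ : CharGroup k A) (a : A) :
    ((H.charAut hS (.ofAdd φ)).app (S a)).hom = ((φ a).toMul : k) • 𝟙 (S a) :=
  (H.exists_tensorAut hS φ).choose_spec a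

end IsSimpleBasis

end CharAut

/-! ### Direct sums and duals -/

namespace Decomposition

section ExactPairing

universe v u

variable {C : Type u} [Category.{v} C] [Preadditive C] [MonoidalCategory C] [MonoidalPreadditive C]
  {J : Type*} [Fintype J] {F G : J → C} {X Y : C} (d : Decomposition F X)
  (d' : Decomposition G Y) [∀ j, ExactPairing (F j) (G j)]

/-- The coevaluation of a direct sum of objects with right duals. -/
def coevaluation : 𝟙_ C ⟶ X ⊗ Y :=
  (d.map (tensorRight Y)).lift fun j => η_ (F j) (G j) ≫ (F j ◁ d'.ι j)

/-- The evaluation of a direct sum of objects with right duals. -/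
def evaluation : Y ⊗ X ⟶ 𝟙_ C :=
  (d'.map (tensorRight X)).desc fun j => (G j ◁ d.π j) ≫ ε_ (F j) (G j)

theorem coevaluation_comp_whiskerRight_π (j : J) :
    d.coevaluation d' ≫ (d.π j ▷ Y) = η_ (F j) (G j) ≫ (F j ◁ d'.ι j) :=
  (d.map (tensorRight Y)).lift_π _ j

theorem whiskerRight_ι_comp_evaluation (j : J) :
    (d'.ι j ▷ X) ≫ d.evaluation d' = (G j ◁ d.π j) ≫ ε_ (F j) (G j) :=
  (d'.map (tensorRight X)).ι_desc _ j

theorem coevaluation_comp_whiskerLeft_π (j : J) :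
    d.coevaluation d' ≫ (X ◁ d'.π j) = η_ (F j) (G j) ≫ (d.ι j ▷ G j) := by
  have h : d.coevaluation d' =
      (d'.map (tensorLeft X)).lift fun j => η_ (F j) (G j) ≫ (d.ι j ▷ G j) := by
    simp only [coevaluation, lift, map, Functor.flip_obj_map, curriedTensor_map_app,
      curriedTensor_obj_map, Category.assoc,
      whisker_exchange]
  rw [h]
  exact (d'.map (tensorLeft X)).lift_π _ j

theorem whiskerLeft_ι_comp_evaluation (j : J) :
    (Y ◁ d.ι j) ≫ d.evaluation d' = (d'.π j ▷ F j) ≫ ε_ (F j) (G j) := by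
  have h : d.evaluation d' =
      (d.map (tensorLeft Y)).desc fun j => (d'.π j ▷ F j) ≫ ε_ (F j) (G j) := by
    simp only [evaluation, desc, map, Functor.flip_obj_map, curriedTensor_map_app,
      curriedTensor_obj_map, whisker_exchange_assoc]
  rw [h]
  exact (d.map (tensorLeft Y)).ι_desc _ j

/-- A direct sum of objects with right duals has a right dual. -/
@[reducible]
def exactPairing : ExactPairing X Y where
  coevaluation' := d.coevaluation d'
  evaluation' := d.evaluation d'
  coevaluation_evaluation' := by
    refine (d'.map (tensorRight (𝟙_ C))).hom_ext fun j => ?_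
    change (d'.ι j ▷ 𝟙_ C) ≫ (Y ◁ d.coevaluation d') ≫ (α_ Y X Y).inv ≫ (d.evaluation d' ▷ Y) =
      (d'.ι j ▷ 𝟙_ C) ≫ (ρ_ Y).hom ≫ (λ_ Y).inv
    rw [← whisker_exchange_assoc, associator_inv_naturality_left_assoc, ← comp_whiskerRight,
      whiskerRight_ι_comp_evaluation, comp_whiskerRight, ← associator_inv_naturality_middle_assoc,
      ← MonoidalCategory.whiskerLeft_comp_assoc, coevaluation_comp_whiskerRight_π,
      MonoidalCategory.whiskerLeft_comp_assoc, associator_inv_naturality_right_assoc,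
      whisker_exchange, ExactPairing.coevaluation_evaluation_assoc]
    simp
  evaluation_coevaluation' := by
    refine (d.map (tensorLeft (𝟙_ C))).hom_ext fun j => ?_
    change (𝟙_ C ◁ d.ι j) ≫ (d.coevaluation d' ▷ X) ≫ (α_ X Y X).hom ≫ (X ◁ d.evaluation d') =
      (𝟙_ C ◁ d.ι j) ≫ (λ_ X).hom ≫ (ρ_ X).inv
    rw [whisker_exchange_assoc, associator_naturality_right_assoc,
      ← MonoidalCategory.whiskerLeft_comp, whiskerLeft_ι_comp_evaluation,
      MonoidalCategory.whiskerLeft_comp, ← associator_naturality_middle_assoc,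
      ← comp_whiskerRight_assoc, coevaluation_comp_whiskerLeft_π, comp_whiskerRight_assoc,
      associator_naturality_left_assoc, ← whisker_exchange,
      ExactPairing.evaluation_coevaluation_assoc]
    simp

end ExactPairing

end Decomposition

/-! ### Direct sums in the center -/

section CenterSums

universe v u

variable {C : Type u} [Category.{v} C] [Preadditive C] [MonoidalCategory C] [MonoidalPreadditive C]

namespace Decomposition

variable {J : Type*} [Fintype J] {F : J → C} {X : C} (d : Decomposition F X)
  (b : ∀ j, HalfBraiding (F j))

/-- The sum of the half-braidings of the summands of a direct sum. -/
def halfBraidingHom (U : C) : X ⊗ U ⟶ U ⊗ X :=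
  (d.map (tensorRight U)).desc fun j => ((b j).β U).hom ≫ (U ◁ d.ι j)

/-- The sum of the inverses of the half-braidings of the summands of a direct sum. -/
def halfBraidingInv (U : C) : U ⊗ X ⟶ X ⊗ U :=
  (d.map (tensorLeft U)).desc fun j => ((b j).β U).inv ≫ (d.ι j ▷ U)

theorem ι_halfBraidingHom (U : C) (j : J) :
    (d.ι j ▷ U) ≫ d.halfBraidingHom b U = ((b j).β U).hom ≫ (U ◁ d.ι j) :=
  (d.map (tensorRight U)).ι_desc _ j

theorem ι_halfBraidingInv (U : C) (j : J) :
    (U ◁ d.ι j) ≫ d.halfBraidingInv b U = ((b j).β U).inv ≫ (d.ι j ▷ U) :=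
  (d.map (tensorLeft U)).ι_desc _ j

theorem halfBraidingHom_π (U : C) (j : J) :
    d.halfBraidingHom b U ≫ (U ◁ d.π j) = (d.π j ▷ U) ≫ ((b j).β U).hom := by
  have h : d.halfBraidingHom b U =
      (d.map (tensorLeft U)).lift fun j => (d.π j ▷ U) ≫ ((b j).β U).hom := by
    simp only [halfBraidingHom, desc, lift, map, Functor.flip_obj_map, curriedTensor_map_app,
      curriedTensor_obj_map, Category.assoc]
  rw [h]
  exact (d.map (tensorLeft U)).lift_π _ j

/-- The half-braiding of a direct sum. -/
def halfBraiding : HalfBraiding X where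
  β U :=
    { hom := d.halfBraidingHom b U
      inv := d.halfBraidingInv b U
      hom_inv_id := (d.map (tensorRight U)).hom_ext fun j => by
        change (d.ι j ▷ U) ≫ d.halfBraidingHom b U ≫ d.halfBraidingInv b U = (d.ι j ▷ U) ≫ 𝟙 _
        rw [reassoc_of% (d.ι_halfBraidingHom b U j), ι_halfBraidingInv, Iso.hom_inv_id_assoc,
          Category.comp_id]
      inv_hom_id := (d.map (tensorLeft U)).hom_ext fun j => by
        change (U ◁ d.ι j) ≫ d.halfBraidingInv b U ≫ d.halfBraidingHom b U = (U ◁ d.ι j) ≫ 𝟙 _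
        rw [reassoc_of% (d.ι_halfBraidingInv b U j), ι_halfBraidingHom, Iso.inv_hom_id_assoc,
          Category.comp_id] }
  monoidal U V := (d.map (tensorRight (U ⊗ V))).hom_ext fun j => by
    change (d.ι j ▷ (U ⊗ V)) ≫ d.halfBraidingHom b (U ⊗ V) = (d.ι j ▷ (U ⊗ V)) ≫
      (α_ _ _ _).inv ≫ (d.halfBraidingHom b U ▷ V) ≫ (α_ _ _ _).hom ≫
        (U ◁ d.halfBraidingHom b V) ≫ (α_ _ _ _).inv
    rw [ι_halfBraidingHom, HalfBraiding.monoidal, associator_inv_naturality_left_assoc,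
      ← comp_whiskerRight_assoc, ι_halfBraidingHom, comp_whiskerRight_assoc,
      associator_naturality_middle_assoc, ← MonoidalCategory.whiskerLeft_comp_assoc,
      ι_halfBraidingHom, MonoidalCategory.whiskerLeft_comp_assoc]
    simp only [Category.assoc, associator_inv_naturality_right]
  naturality {U V} f := (d.map (tensorRight U)).hom_ext fun j => by
    change (d.ι j ▷ U) ≫ (X ◁ f) ≫ d.halfBraidingHom b V =
      (d.ι j ▷ U) ≫ d.halfBraidingHom b U ≫ (f ▷ X)
    rw [← whisker_exchange_assoc, ι_halfBraidingHom, reassoc_of% (d.ι_halfBraidingHom b U j),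
      HalfBraiding.naturality_assoc, whisker_exchange]

end Decomposition

instance : (Center.forget C).Additive where
  map_add := rfl

theorem center_sum_f {J : Type*} (s : Finset J) {X Y : Center C} (f : J → (X ⟶ Y)) :
    (∑ j ∈ s, f j).f = ∑ j ∈ s, (f j).f :=
  (Center.forget C).map_sum f s

theorem nonempty_decomposition_center {J : Type*} [Fintype J] {F : J → Center C} {X : Center C}
    (d : Decomposition (fun j => (F j).1) X.1) (hι : ∀ j, ∃ i : F j ⟶ X, i.f = d.ι j)
    (hπ : ∀ j, ∃ p : X ⟶ F j, p.f = d.π j) : Nonempty (Decomposition F X) := by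
  choose i hi using hι
  choose p hp using hπ
  refine ⟨⟨i, p, fun j => Center.ext _ _ ?_, fun j l h => Center.ext _ _ ?_, Center.ext _ _ ?_⟩⟩
  · rw [Center.comp_f, hi, hp]
    exact d.ι_π j
  · rw [Center.comp_f, hi, hp]
    exact d.ι_π_ne j l h
  · simp only [center_sum_f, Center.comp_f, hi, hp]
    exact d.total

theorem center_exists_decomposition [HasFiniteBiproducts C] {n : ℕ} (F : Fin n → Center C) :
    ∃ X : Center C, Nonempty (Decomposition F X) :=
  let d := Decomposition.ofBicone _ (biproduct.isBilimit fun j => (F j).1)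
  let b (j : Fin n) := (F j).2
  ⟨⟨_, d.halfBraiding b⟩, nonempty_decomposition_center (X := ⟨_, d.halfBraiding b⟩) d
    (fun j => ⟨⟨d.ι j, fun U => d.ι_halfBraidingHom b U j⟩, rfl⟩)
    fun j => ⟨⟨d.π j, fun U => (d.halfBraidingHom_π b U j).symm⟩, rfl⟩⟩

instance [HasFiniteBiproducts C] : HasFiniteBiproducts (Center C) where
  out n :=
    { has_biproduct := fun F => by
        obtain ⟨X, ⟨d⟩⟩ := center_exists_decomposition F
        exact HasBiproduct.mk ⟨d.bicone, d.isBilimit⟩ }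

end CenterSums

/-! ### The simple objects of the center -/

section CenterBasis

universe w v u uA

variable {C : Type u} [Category.{v} C] [MonoidalCategory C] [Preadditive C] [MonoidalPreadditive C]
  {k : Type w} [Field k] [Linear k C]

theorem IsSimpleBasis.exists_centerHom {I : Type*} {S : I → C} (H : IsSimpleBasis k S)
    (Z W : Center C) (f : Z.1 ⟶ W.1)
    (hf : ∀ i, (f ▷ S i) ≫ (W.2.β (S i)).hom = (Z.2.β (S i)).hom ≫ (S i ◁ f)) :
    ∃ g : Z ⟶ W, g.f = f := by
  refine ⟨⟨f, fun U => H.hom_ext_map (tensorLeft Z.1) fun i u => ?_⟩, rfl⟩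
  change (Z.1 ◁ u) ≫ (f ▷ U) ≫ (W.2.β U).hom = (Z.1 ◁ u) ≫ (Z.2.β U).hom ≫ (U ◁ f)
  rw [whisker_exchange_assoc, HalfBraiding.naturality, reassoc_of% (hf i),
    HalfBraiding.naturality_assoc, whisker_exchange]

variable [BraidedCategory C] [MonoidalLinear k C] {A : Type uA} [AddCommGroup A] {S : A → C}

namespace IsSimpleBasis

theorem exists_decomposition_centerLift [IsIdempotentComplete C] [IsAlgClosed k] [Finite A]
    [NeZero (Nat.card A : k)] [Fintype (CharGroup k A)] (H : IsSimpleBasis k S)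
    (hS : ∀ a b, Nonempty (S a ⊗ S b ≅ S (a + b))) (h0 : Nonempty (𝟙_ C ≅ S 0)) (Z : Center C) :
    ∃ Y : CharGroup k A → C,
      Nonempty (Decomposition (fun φ => centerLift (H.charAut hS (.ofAdd φ)) (Y φ)) Z) := by
  obtain ⟨X, b⟩ := Z
  obtain ⟨ρ, hρ⟩ := exists_monoidHom_isDeviation hS h0 b
  obtain ⟨Y, d, hd⟩ := exists_isotypic_decomposition (k := k) ρ
  refine ⟨Y, nonempty_decomposition_center (X := ⟨X, b⟩) d (fun φ => ?_) fun φ => ?_⟩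
  · refine H.exists_centerHom (centerLift _ (Y φ)) ⟨X, b⟩ (d.ι φ) fun a => ?_
    change (d.ι φ ▷ S a) ≫ (b.β (S a)).hom = ((twistedHalfBraiding _ (Y φ)).β (S a)).hom ≫ _
    rw [hρ, ← comp_whiskerRight_assoc, (hd φ a).1, twistedHalfBraiding_β_hom, H.charAut_app_hom]
    simp
  · refine H.exists_centerHom ⟨X, b⟩ (centerLift _ (Y φ)) (d.π φ) fun a => ?_
    change (d.π φ ▷ S a) ≫ ((twistedHalfBraiding _ (Y φ)).β (S a)).hom = (b.β (S a)).hom ≫ _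
    rw [hρ, Category.assoc, ← BraidedCategory.braiding_naturality_left, ← comp_whiskerRight_assoc,
      (hd φ a).2, twistedHalfBraiding_β_hom, H.charAut_app_hom]
    simp

/-- The simple object of the center indexed by `(a, φ)`: the object `S a`, with the braiding
twisted by `φ`. -/
def centerSimple (H : IsSimpleBasis k S) (hS : ∀ a b, Nonempty (S a ⊗ S b ≅ S (a + b)))
    (p : A × CharGroup k A) : Center C :=
  centerLift (H.charAut hS (.ofAdd p.2)) (S p.1)

variable (H : IsSimpleBasis k S) (hS : ∀ a b, Nonempty (S a ⊗ S b ≅ S (a + b)))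

theorem nonempty_centerSimple_tensor_iso (p p' : A × CharGroup k A) :
    Nonempty (H.centerSimple hS p ⊗ H.centerSimple hS p' ≅ H.centerSimple hS (p + p')) := by
  rw [centerSimple, centerSimple, centerSimple, Prod.snd_add, ofAdd_add, map_mul]
  exact nonempty_centerLift_tensor_iso _ _ (hS p.1 p'.1).some

theorem nonempty_unit_centerSimple_iso (h0 : Nonempty (𝟙_ C ≅ S 0)) :
    Nonempty (𝟙_ (Center C) ≅ H.centerSimple hS 0) := by
  rw [centerSimple, Prod.snd_zero, ofAdd_zero, map_one]
  exact nonempty_unit_centerLift_iso h0.some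

theorem braiding_centerSimple {q : A → kˣ}
    (hq : ∀ a, (β_ (S a) (S a)).hom = (q a : k) • 𝟙 (S a ⊗ S a)) (p : A × CharGroup k A) :
    (β_ (H.centerSimple hS p) (H.centerSimple hS p)).hom = (centerForm q p : k) • 𝟙 _ := by
  refine Center.ext _ _ ?_
  change ((twistedHalfBraiding (H.charAut hS (.ofAdd p.2)) (S p.1)).β (S p.1)).hom =
    (centerForm q p : k) • 𝟙 (S p.1 ⊗ S p.1)
  rw [twistedHalfBraiding_β_hom, hq, H.charAut_app_hom]
  simp [centerForm, smul_smul, mul_comm]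

theorem homOrthogonal_centerSimple (h0 : Nonempty (𝟙_ C ≅ S 0)) :
    HomOrthogonal (H.centerSimple hS) := by
  rintro ⟨a, φ⟩ ⟨a', ψ⟩ h
  refine subsingleton_of_forall_eq 0 fun f => Center.ext _ _ ?_
  rcases eq_or_ne a a' with rfl | ha
  · obtain ⟨b, hb⟩ := DFunLike.ne_iff.1 fun h' : φ = ψ => h (by rw [h'])
    have := (isInvertibleObject_of_tensor_iso hS h0 b).isEquivalence_tensorRight
    refine (tensorRight (S b)).map_injective ?_
    refine (whiskerRight_f_eq_zero_of_ne f (H.charAut_app_hom hS _ b) (H.charAut_app_hom hS _ b)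
      fun h' => hb (Units.ext h')).trans ?_
    exact ((tensorRight (S b)).map_zero _ _).symm
  · exact H.homOrthogonal.eq_zero ha f.f

theorem center [IsIdempotentComplete C] [IsAlgClosed k] [Finite A] [NeZero (Nat.card A : k)]
    (h0 : Nonempty (𝟙_ C ≅ S 0)) : IsSimpleBasis k (H.centerSimple hS) where
  id_ne_zero p h := H.id_ne_zero p.1 (congrArg Center.Hom.f h)
  schur p f := by
    obtain ⟨c, hc⟩ := H.schur p.1 f.f
    exact ⟨c, Center.ext _ _ hc⟩
  homOrthogonal := H.homOrthogonal_centerSimple hS h0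
  exists_decomposition Z := by
    have := Fintype.ofFinite (CharGroup k A)
    obtain ⟨Y, ⟨d⟩⟩ := H.exists_decomposition_centerLift hS h0 Z
    choose n s d' using fun φ => H.exists_decomposition (Y φ)
    let e := (Fintype.equivFin (Σ φ, Fin (n φ))).symm
    exact ⟨_, fun j => (s (e j).1 (e j).2, (e j).1),
      ⟨(d.sigma fun φ => (d' φ).some.map (centerLiftFunctor _)).reindex e⟩⟩

theorem nonempty_rigid_center (H : IsSimpleBasis k S)
    (hS : ∀ a b, Nonempty (S a ⊗ S b ≅ S (a + b))) [HasFiniteBiproducts C] [IsIdempotentComplete C]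
    [RightRigidCategory C] [IsAlgClosed k] [Finite A] [NeZero (Nat.card A : k)]
    (h0 : Nonempty (𝟙_ C ≅ S 0)) : Nonempty (RigidCategory (Center C)) := by
  have (Z : Center C) : Nonempty (HasRightDual Z) := by
    obtain ⟨n, s, ⟨d⟩⟩ := (H.center hS h0).exists_decomposition Z
    let τ (j : Fin n) := H.charAut hS (.ofAdd (s j).2)
    obtain ⟨Y, ⟨d'⟩⟩ := center_exists_decomposition fun j => centerLift (τ j)⁻¹ (S (s j).1)ᘁ
    have (j : Fin n) : ExactPairing (H.centerSimple hS (s j)) (centerLift (τ j)⁻¹ (S (s j).1)ᘁ) :=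
      centerLiftExactPairing (τ j) (S (s j).1) (S (s j).1)ᘁ
    exact ⟨{ rightDual := Y, exact := d.exactPairing d' }⟩
  let _ : RightRigidCategory (Center C) := { rightDual := fun Z => (this Z).some }
  exact ⟨BraidedCategory.rigidCategoryOfRightRigidCategory⟩

end IsSimpleBasis

end CenterBasis

section Main

universe w v u uA

theorem IsQuadraticForm.centerForm {k : Type w} [Field k] {A : Type u} [AddCommGroup A]
    {q : A → kˣ} (hq : IsQuadraticForm q) : IsQuadraticForm (centerForm q) where
  map_neg := by
    rintro ⟨a, φ⟩
    simp [PointedCenter.centerForm, hq.map_neg]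
  map_add_left := by
    rintro ⟨a, φ⟩ ⟨b, ψ⟩ ⟨c, χ⟩
    have h := congrArg Additive.ofMul (hq.map_add_left a b c)
    apply Additive.ofMul.injective
    simp only [PointedCenter.centerForm, Prod.mk_add_mk, map_add, AddMonoidHom.add_apply,
      ofMul_mul, ofMul_div, ofMul_toMul] at h ⊢
    linear_combination (norm := abel_nf) h
  map_add_right := by
    rintro ⟨a, φ⟩ ⟨b, ψ⟩ ⟨c, χ⟩
    have h := congrArg Additive.ofMul (hq.map_add_right a b c)
    apply Additive.ofMul.injective
    simp only [PointedCenter.centerForm, Prod.mk_add_mk, map_add, AddMonoidHom.add_apply,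
      ofMul_mul, ofMul_div, ofMul_toMul] at h ⊢
    linear_combination (norm := abel_nf) h

theorem IsAbelian.isIdempotentComplete {C : Type u} [Category.{v} C] [Preadditive C]
    (h : IsAbelian C) : IsIdempotentComplete C := by
  obtain ⟨_, _, _, _, _⟩ := h
  let _ : Abelian C := {}
  infer_instance

theorem IsSimpleBasis.isPointedBraidedFusion {C : Type u} [Category.{v} C] [Preadditive C]
    {k : Type w} [Field k] [Linear k C] [MonoidalCategory C] [MonoidalPreadditive C]
    [MonoidalLinear k C] [BraidedCategory C] [HasFiniteBiproducts C] {A : Type uA}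
    [AddCommGroup A] [Finite A] {S : A → C} {q : A → kˣ} (H : IsSimpleBasis k S)
    (hr : Nonempty (RigidCategory C))
    (hS : ∀ a b, Nonempty (S a ⊗ S b ≅ S (a + b))) (h0 : Nonempty (𝟙_ C ≅ S 0))
    (hq : ∀ a, (β_ (S a) (S a)).hom = (q a : k) • 𝟙 (S a ⊗ S a)) :
    IsPointedBraidedFusion k C A q where
  isFusion := H.isFusionCategory hr 0 h0
  isPointed X _ := by
    obtain ⟨a, ⟨e⟩⟩ := H.exists_iso_of_simple X
    exact (isInvertibleObject_of_tensor_iso hS h0 a).of_iso e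
  hasInvariant :=
    ⟨S, H.simple, fun X _ => H.exists_iso_of_simple X, fun _ _ ⟨e⟩ => H.eq_of_iso e, hS, hq⟩

theorem IsPointedBraidedFusion.center {C : Type u} [Category.{v} C] [Preadditive C] {k : Type w}
    [Field k] [IsAlgClosed k] [Linear k C] [MonoidalCategory C] [MonoidalPreadditive C]
    [MonoidalLinear k C] [BraidedCategory C] {A : Type uA} [AddCommGroup A] [Finite A]
    [NeZero (Nat.card A : k)] {q : A → kˣ} (hC : IsPointedBraidedFusion k C A q) :
    IsPointedBraidedFusion k (Center C) (A × CharGroup k A) (centerForm q) := by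
  obtain ⟨S, hS₁, hS₂, hS₃, hS, hq⟩ := hC.hasInvariant
  have H := hC.isFusion.isSimpleBasis S hS₁ hS₂ hS₃
  have h0 := H.nonempty_unit_iso hS hC.isFusion.simple_unit
  have := hC.isFusion.isAbelian.isIdempotentComplete
  have := hC.isFusion.isAbelian.hasFiniteProducts
  have : HasFiniteBiproducts C := HasFiniteBiproducts.of_hasFiniteProducts
  obtain ⟨_⟩ := hC.isFusion.rigid
  exact (H.center hS h0).isPointedBraidedFusion (H.nonempty_rigid_center hS h0)
    (H.nonempty_centerSimple_tensor_iso hS) (H.nonempty_unit_centerSimple_iso hS h0)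
    (H.braiding_centerSimple hS hq)

end Main

end

end PointedCenter

theorem mainTheorem10_general
    (k : Type*) [Field k] [IsAlgClosed k]
    (A : Type*) [AddCommGroup A] [Finite A] [NeZero (Nat.card A : k)]
    (q : A → kˣ) (hq : PointedCenter.IsQuadraticForm q)
    (C : Type*) [Category* C] [Preadditive C] [Linear k C] [MonoidalCategory C]
    [MonoidalPreadditive C] [MonoidalLinear k C] [BraidedCategory C]
    (hC : PointedCenter.IsPointedBraidedFusion k C A q) :
    PointedCenter.IsFusionCategory k (Center C) ∧
    PointedCenter.IsPointed (Center C) ∧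
    PointedCenter.IsQuadraticForm (PointedCenter.centerForm q) ∧
    PointedCenter.HasInvariant k (Center C)
      (A × PointedCenter.CharGroup k A) (PointedCenter.centerForm q) ∧
    ∀ (D : Type*) [Category* D] [Preadditive D] [Linear k D] [MonoidalCategory D]
      [MonoidalPreadditive D] [MonoidalLinear k D] [BraidedCategory D],
      PointedCenter.IsPointedBraidedFusion k D
        (A × PointedCenter.CharGroup k A) (PointedCenter.centerForm q) →
      PointedCenter.BraidedEquivalent k (Center C) D := by
  have hZ := hC.center
  exact ⟨hZ.isFusion, hZ.isPointed, hq.centerForm, hZ.hasInvariant,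
    fun _ _ _ _ _ _ _ _ hD => hZ.braidedEquivalent hD⟩

theorem mainTheorem10
    (k : Type*) [Field k] [IsAlgClosed k] [CharZero k]
    (A : Type*) [AddCommGroup A] [Finite A]
    (q : A → kˣ) (hq : PointedCenter.IsQuadraticForm q)
    (C : Type*) [Category* C] [Preadditive C] [Linear k C] [MonoidalCategory C]
    [MonoidalPreadditive C] [MonoidalLinear k C] [BraidedCategory C]
    (hC : PointedCenter.IsPointedBraidedFusion k C A q) :
    PointedCenter.IsFusionCategory k (Center C) ∧
    PointedCenter.IsPointed (Center C) ∧
    PointedCenter.IsQuadraticForm (PointedCenter.centerForm q) ∧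
    PointedCenter.HasInvariant k (Center C)
      (A × PointedCenter.CharGroup k A) (PointedCenter.centerForm q) ∧
    ∀ (D : Type*) [Category* D] [Preadditive D] [Linear k D] [MonoidalCategory D]
      [MonoidalPreadditive D] [MonoidalLinear k D] [BraidedCategory D],
      PointedCenter.IsPointedBraidedFusion k D
        (A × PointedCenter.CharGroup k A) (PointedCenter.centerForm q) →
      PointedCenter.BraidedEquivalent k (Center C) D := by
  have : NeZero (Nat.card A : k) := ⟨Nat.cast_ne_zero.2 Nat.card_pos.ne'⟩
  exact mainTheorem10_general k A q hq C hC
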